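/- A clustering instance on $n$ points is a set $V$ with $|V|=n$ together with a metric $d$ on $V$. For $\alpha\in\mathbb R$, $\alpha$-linkage (the family $\mathcal A_2$) starts from the $n$ singletons and repeatedly merges two current clusters $A\neq B$ that minimize $$\frac1{|A||B|}\sum_{x\in A,\,y\in B} d(x,y)^{\alpha},$$ until one cluster is left; ties may be broken in any way. Its merge tree is the tree of all clusters formed. For $p\in[1,\infty]$ and a partition $\mathcal C=\{C_1,\dots,C_k\}$ of $V$ with centers $c_i\in C_i$, let $\Phi^{(p)}(\mathcal C,\mathbf c)=\sum_{i=1}^k\bigl(\sum_{q\in C_i}d(q,c_i)^p\bigr)^{1/p}$ (for $p=\infty$ the inner term is $\max_{q\in C_i}d(q,c_i)$). The algorithm $\mathcal A_2(\alpha)$ builds a merge tree by $\alpha$-linkage and returns a partition of $V$ into $k$ nodes of the tree, with centers $c_i \in C_i$, that minimizes $\Phi^{(p)}$ among all such partitions and centers. The pseudo-dimension of a class $H$ of real functions on a set $X$ is the supremum of the sizes of finite sets $S\subseteq X$ shattered by $H$, i.e. such that there are witnesses $(r_x)_{x\in S}$ such that for each $T\subseteq S$ some $h\in H$ satisfies $h(x)\le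 r_x\iff x\in T$ for all $x\in S$. (1) For every $n\ge 8$, with $N=\lfloor (n-8)/2\rfloor$, there are a clustering instance on $n$ points and a set of $2^N+2$ values $\alpha\in(1,3)$ such that for each of them the merge tree of $\alpha$-linkage is unique (it does not depend on how ties are broken), and these merge trees are pairwise distinct. (2) There is an absolute constant $c>0$ such that for every $k\ge2$ there is $n_0$ such that for all $n\ge n_0$, all $p\in[1,\infty]$, and every rule for breaking ties: (a) the class of functions $\mathcal V\mapsto \Phi^{(p)}(\mathcal A_2(\alpha)(\mathcal V))$, $\alpha\in(1,3)$, on clustering instances with $n$ points shatters a set of at least $cn$ instances; in particular the class with $\alpha\in\mathbb R$ has pseudo-dimension at least $cn$; (b) the same holds, on the set of pairs $(\mathcal V,\mathcal G)$ of a clustering instance $\mathcal V$ with $n$ points and a ground truth clustering $\mathcal G$ of its points into $k$ nonempty clusters, for the functions that send $(\mathcal V,\mathcal G)$ to the distance between the clustering returned by $\mathcal A_2(\alpha)$ on $\mathcal V$ and $\mathcal G$. Here the distance of two clusterings $\{C_i\}_{i\le k}$, $\{G_i\}_{i\le k}$ is the number of misclassified points, $\min_\sigma\sum_i|C_i\setminus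 G_{\sigma(i)}|$ over permutations $\sigma$. -/

import Mathlib

open scoped ENNReal

/-- A clustering instance on `n` points: a metric on the point set `Fin n`. -/
structure ClusteringInstance (n : ℕ) where
  /-- the pairwise distances -/
  d : Fin n → Fin n → ℝ
  d_nonneg : ∀ x y, 0 ≤ d x y
  d_eq_zero_iff : ∀ x y, d x y = 0 ↔ x = y
  d_comm : ∀ x y, d x y = d y x
  d_triangle : ∀ x y z, d x z ≤ d x y + d y z

/-- The average-linkage power merge function: the mean of `d(x, y) ^ α` over the pairs in
`A × B`. -/
noncomputable def avgPowLinkage {n : ℕ} (V : ClusteringInstance n) (α : ℝ)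
    (A B : Finset (Fin n)) : ℝ :=
  (∑ x ∈ A, ∑ y ∈ B, V.d x y ^ α) / ((A.card : ℝ) * (B.card : ℝ))

/-- The clusters before the first merge: all singletons. -/
def singletonClusters (n : ℕ) : Finset (Finset (Fin n)) :=
  Finset.univ.image (fun x : Fin n => ({x} : Finset (Fin n)))

/-- `LinkageRun V α P T`: some run of agglomerative clustering with the merge function
`avgPowLinkage V α` (ties may be broken in any way) arrives at the set `P` of current clusters,
`T` being the set of all clusters formed up to then. -/
inductive LinkageRun {n : ℕ} (V : ClusteringInstance n) (α : ℝ) :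
    Finset (Finset (Fin n)) → Finset (Finset (Fin n)) → Prop
  | start : LinkageRun V α (singletonClusters n) (singletonClusters n)
  | merge {P T : Finset (Finset (Fin n))} {A B : Finset (Fin n)} :
      LinkageRun V α P T → A ∈ P → B ∈ P → A ≠ B →
      (∀ X ∈ P, ∀ Y ∈ P, X ≠ Y → avgPowLinkage V α A B ≤ avgPowLinkage V α X Y) →
      LinkageRun V α (insert (A ∪ B) ((P.erase A).erase B)) (insert (A ∪ B) T)

/-- `T` is the set of nodes of a cluster tree (merge tree) that `α`-linkage can build on `V`: the
nodes are the clusters of a run that ends with the single cluster of all points. A binary cluster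
tree, up to exchanging left and right children, is determined by the set of its nodes. -/
def IsMergeTree {n : ℕ} (V : ClusteringInstance n) (α : ℝ) (T : Finset (Finset (Fin n))) : Prop :=
  LinkageRun V α {Finset.univ} T

/-- The `ℓ^p` cost `(∑_{q ∈ C} d(q, c)^p)^{1/p}` of a cluster `C` with center `c`; for `p = ∞` it
is `max_{q ∈ C} d(q, c)`. -/
noncomputable def clusterCost {n : ℕ} (V : ClusteringInstance n) (p : ℝ≥0∞)
    (C : Finset (Fin n)) (c : Fin n) : ℝ :=
  if p = ∞ then ⨆ q : {q : Fin n // q ∈ C}, V.d q.1 c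
  else (∑ q ∈ C, V.d q c ^ p.toReal) ^ (1 / p.toReal)

/-- The objective `Φ^(p)` of a clustering `P` of all points, the center of the cluster `C` being
`c C`. -/
noncomputable def clusteringObjective {n : ℕ} (V : ClusteringInstance n) (p : ℝ≥0∞)
    (P : Finpartition (Finset.univ : Finset (Fin n))) (c : Finset (Fin n) → Fin n) : ℝ :=
  ∑ C ∈ P.parts, clusterCost V p C (c C)

/-- `(P, c)` is a `k`-pruning of the cluster tree with node set `T`, with a center chosen in each
cluster: a partition of the points into `k` nodes of the tree. -/
def IsCenteredPruning {n : ℕ} (T : Finset (Finset (Fin n))) (k : ℕ)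
    (P : Finpartition (Finset.univ : Finset (Fin n))) (c : Finset (Fin n) → Fin n) : Prop :=
  P.parts ⊆ T ∧ P.parts.card = k ∧ ∀ C ∈ P.parts, c C ∈ C

/-- `(P, c)` is a possible output on `V` of `α`-linkage followed by the pruning step with pruning
function `Φ^(p)`: an optimal `k`-pruning of a cluster tree that `α`-linkage can build. -/
def IsAlgorithmOutput {n : ℕ} (p : ℝ≥0∞) (k : ℕ) (α : ℝ) (V : ClusteringInstance n)
    (P : Finpartition (Finset.univ : Finset (Fin n))) (c : Finset (Fin n) → Fin n) : Prop :=
  ∃ T : Finset (Finset (Fin n)), IsMergeTree V α T ∧ IsCenteredPruning T k P c ∧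
    ∀ (P' : Finpartition (Finset.univ : Finset (Fin n))) (c' : Finset (Fin n) → Fin n),
      IsCenteredPruning T k P' c' →
        clusteringObjective V p P c ≤ clusteringObjective V p P' c'

/-- The distance between two clusterings with the same number of clusters: the least number of
misclassified points over all matchings of the clusters of `P` with those of `Q`. -/
noncomputable def clusteringDist {n : ℕ} (P Q : Finpartition (Finset.univ : Finset (Fin n))) : ℕ :=
  ⨅ σ : {C // C ∈ P.parts} ≃ {C // C ∈ Q.parts},
    ∑ C : {C // C ∈ P.parts}, (C.1 \ (σ C).1).card

/-- A clustering instance with a ground truth clustering into `k` clusters. -/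
abbrev LabeledInstance (n k : ℕ) : Type :=
  ClusteringInstance n ×
    {Q : Finpartition (Finset.univ : Finset (Fin n)) // Q.parts.card = k}

/-- The finite set `S` is shattered by the class `H` of real functions: there are witnesses `r`
such that for every `T ⊆ S` some `h ∈ H` satisfies, for all `x ∈ S`, `h x ≤ r x` iff `x ∈ T`. -/
def IsShattered {X : Type*} (H : Set (X → ℝ)) (S : Finset X) : Prop :=
  ∃ r : X → ℝ, ∀ T ⊆ S, ∃ h ∈ H, ∀ x ∈ S, h x ≤ r x ↔ x ∈ T

/-- The pseudo-dimension of a class of real functions: the supremum of the cardinalities of the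
finite sets that it shatters. -/
noncomputable def pseudoDimension {X : Type*} (H : Set (X → ℝ)) : ℕ∞ :=
  ⨆ S : {S : Finset X // IsShattered H S}, (S.1.card : ℕ∞)

/-- An algorithm family on instances with `n` points: for each parameter `α` and each instance, a
clustering with centers. -/
abbrev AlgorithmFamily (n : ℕ) : Type :=
  ℝ → ClusteringInstance n →
    Finpartition (Finset.univ : Finset (Fin n)) × (Finset (Fin n) → Fin n)

/-- `alg` implements, for all real parameters `α`, average linkage with power `α` and `k`-pruning
by `Φ^(p)`, ties being broken by some rule. -/
def AlgorithmFamily.Implements {n : ℕ} (alg : AlgorithmFamily n) (p : ℝ≥0∞) (k : ℕ) : Prop :=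
  ∀ (α : ℝ) (V : ClusteringInstance n), IsAlgorithmOutput p k α V (alg α V).1 (alg α V).2

/-- The class of functions `V ↦ Φ^(p)(output of the algorithm with parameter α on V)`, `α ∈ I`. -/
def objectiveClass {n : ℕ} (alg : AlgorithmFamily n) (p : ℝ≥0∞) (I : Set ℝ) :
    Set (ClusteringInstance n → ℝ) :=
  {h | ∃ α ∈ I, h = fun V => clusteringObjective V p (alg α V).1 (alg α V).2}

/-- The class of functions that send an instance with a ground truth clustering to the distance
between that clustering and the output of the algorithm with parameter `α`, `α ∈ I`. -/
def groundTruthClass {n : ℕ} (alg : AlgorithmFamily n) (k : ℕ) (I : Set ℝ) :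
    Set (LabeledInstance n k → ℝ) :=
  {h | ∃ α ∈ I, h = fun V => (clusteringDist (alg α V.1).1 V.2.1 : ℝ)}

/-!
Write `α = 2 + 2 ε b`, so that average linkage compares means of `(d ^ 2) ^ (1 + ε b)`. A set of
core points, the anchors `0, 1, 2, 3` and later ones, is inserted in its order into two growing
clusters `A ∋ 0, 2` and `B ∋ 1, 3`: the scale `level n y` of the squared distances of `y` to the
earlier points increases with `y`, and the clusters do not merge because the anchors repel each
other. The other points come in pairs `2t, 2t + 1` that repel each other, so that the point `2t + 1`
goes to the cluster that `2t` did not choose.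

For `ε = 0` the point `2t` is tied between `A` and `B`; every other comparison is strict and hence
stable under small perturbations (`eventually_sqLinkage_lt`). The derivative in `ε` of the
difference of the two linkages has two contributions. The squared distances to `0, 2` have the same
sum as those to `1, 3` but are more spread out, which gives a positive multiple `κ b` of `b`
(`anchorGap_pos`). The squared distance of `2t` to `2s` with `s < t` is moreover perturbed by
`ε κ 2 ^ (-s)`, which subtracts `κ` times the part of a signed binary expansion of `b` that the
earlier points have recorded by their choices. So the point `2t` reads off the `t`-th signed binary
digit of `b` (`eventually_wrong_side`). For one sufficiently small `ε`, every bit pattern `T` is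
thus realized by some `α ∈ (1, 3)` without a tie between insertions (`exists_perturbation`), and the
run is forced (`LinkageRun.eq_or_formed_subset`). Merge trees are laminar, so that different patterns give
different trees (`eq_of_laminar_cluster`).

For the pruning, `k - 2` further points are put far away from everything. An optimal `k`-pruning has
to isolate them, and laminarity then leaves only the clusters `A` and `B`
(`eq_twoColorPartition_of_optimal`). The anchors `0` and `1` are optimal centers at constant
distances from the later core points, except that in the `j`-th instance the point `2j + 1` is
slightly further away from `1`; this increases the cost exactly when it lies in `B`, that is, when
bit `j` is not set (`clusteringObjective_le_iff`). For the distance to a ground truth one metric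
suffices: if the ground truth groups `1` with `2j` and leaves the other core points together, then
each pair other than `0, 1` and `2j, 2j + 1` contributes one misclassified point regardless of its
bit, so that the distance reveals bit `j`
(`clusteringDist_truth_le_iff`).
-/

open Filter Topology

/-! ### Runs of the linkage procedure -/

lemma avgPowLinkage_comm {n : ℕ} (V : ClusteringInstance n) (α : ℝ) (A B : Finset (Fin n)) :
    avgPowLinkage V α A B = avgPowLinkage V α B A := by
  unfold avgPowLinkage
  rw [Finset.sum_comm, mul_comm (A.card : ℝ)]
  simp_rw [V.d_comm]

lemma LinkageRun.singletonClusters_subset {n : ℕ} {V : ClusteringInstance n} {α : ℝ}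
    {P T : Finset (Finset (Fin n))} (h : LinkageRun V α P T) : singletonClusters n ⊆ T := by
  induction h with
  | start => exact subset_rfl
  | merge _ _ _ _ _ ih => exact ih.trans (Finset.subset_insert _ _)

/-- The clusters formed by a run are a laminar family; the current clusters are its maximal
members. -/
lemma LinkageRun.laminar_aux {n : ℕ} {V : ClusteringInstance n} {α : ℝ}
    {P T : Finset (Finset (Fin n))} (h : LinkageRun V α P T) :
    (∀ X ∈ P, ∀ Y ∈ P, X ≠ Y → Disjoint X Y) ∧
    (∀ X ∈ T, ∀ Y ∈ P, X ⊆ Y ∨ Disjoint X Y) ∧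
    (∀ X ∈ T, ∀ Y ∈ T, X ⊆ Y ∨ Y ⊆ X ∨ Disjoint X Y) := by
  induction h with
  | start =>
    have key : ∀ X ∈ singletonClusters n, ∀ Y ∈ singletonClusters n, X ≠ Y → Disjoint X Y := by
      intro X hX Y hY hne
      simp only [singletonClusters, Finset.mem_image, Finset.mem_univ, true_and] at hX hY
      obtain ⟨x, rfl⟩ := hX
      obtain ⟨y, rfl⟩ := hY
      simpa using fun h => hne (by rw [h])
    refine ⟨key, fun X hX Y hY => ?_, fun X hX Y hY => ?_⟩
    · rcases eq_or_ne X Y with rfl | hne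
      · exact Or.inl subset_rfl
      · exact Or.inr (key X hX Y hY hne)
    · rcases eq_or_ne X Y with rfl | hne
      · exact Or.inl subset_rfl
      · exact Or.inr (Or.inr (key X hX Y hY hne))
  | @merge P T A B _ hA hB hAB _ ih =>
    obtain ⟨h1, h2, h3⟩ := ih
    have hnew : ∀ Y ∈ (P.erase A).erase B, Disjoint (A ∪ B) Y := by
      intro Y hY
      simp only [Finset.mem_erase] at hY
      exact Finset.disjoint_union_left.2
        ⟨h1 A hA Y hY.2.2 (Ne.symm hY.2.1), h1 B hB Y hY.2.2 (Ne.symm hY.1)⟩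
    have hold : ∀ X ∈ T, X ⊆ A ∪ B ∨ Disjoint X (A ∪ B) := by
      intro X hX
      rcases h2 X hX A hA with h | h
      · exact Or.inl (h.trans Finset.subset_union_left)
      rcases h2 X hX B hB with h' | h'
      · exact Or.inl (h'.trans Finset.subset_union_right)
      · exact Or.inr (Finset.disjoint_union_right.2 ⟨h, h'⟩)
    refine ⟨?_, ?_, ?_⟩
    · intro X hX Y hY hne
      rcases Finset.mem_insert.1 hX with rfl | hX' <;> rcases Finset.mem_insert.1 hY with rfl | hY'
      · exact absurd rfl hne
      · exact hnew Y hY'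
      · exact (hnew X hX').symm
      · exact h1 X (Finset.mem_of_mem_erase (Finset.mem_of_mem_erase hX')) Y
          (Finset.mem_of_mem_erase (Finset.mem_of_mem_erase hY')) hne
    · intro X hX Y hY
      rcases Finset.mem_insert.1 hX with rfl | hX' <;> rcases Finset.mem_insert.1 hY with rfl | hY'
      · exact Or.inl subset_rfl
      · exact Or.inr (hnew Y hY')
      · exact hold X hX'
      · exact h2 X hX' Y (Finset.mem_of_mem_erase (Finset.mem_of_mem_erase hY'))
    · intro X hX Y hY
      rcases Finset.mem_insert.1 hX with rfl | hX' <;> rcases Finset.mem_insert.1 hY with rfl | hY'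
      · exact Or.inl subset_rfl
      · rcases hold Y hY' with h | h
        · exact Or.inr (Or.inl h)
        · exact Or.inr (Or.inr h.symm)
      · rcases hold X hX' with h | h
        · exact Or.inl h
        · exact Or.inr (Or.inr h)
      · exact h3 X hX' Y hY'

lemma IsMergeTree.laminar {n : ℕ} {V : ClusteringInstance n} {α : ℝ}
    {T : Finset (Finset (Fin n))} (h : IsMergeTree V α T) {X Y : Finset (Fin n)}
    (hX : X ∈ T) (hY : Y ∈ T) : X ⊆ Y ∨ Y ⊆ X ∨ Disjoint X Y :=
  (LinkageRun.laminar_aux h).2.2 X hX Y hY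

/-! ### Inserting the points one by one into two growing clusters -/

/-- The points with index below `v` that the colouring `side` sends to `s`. -/
def cluster (n : ℕ) (side : ℕ → Bool) (s : Bool) (v : ℕ) : Finset (Fin n) :=
  Finset.univ.filter fun x => x.1 < v ∧ side x.1 = s

/-- The clusters present when exactly the points below `v` have been inserted: two colour classes
and the singletons of the remaining points. -/
def currentClusters (n : ℕ) (side : ℕ → Bool) (v : ℕ) : Finset (Finset (Fin n)) :=
  insert (cluster n side false v) (insert (cluster n side true v)
    ((Finset.univ.filter fun x : Fin n => v ≤ x.1).image fun x => {x}))

/-- All clusters formed until the points below `v` have been inserted. -/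
def formedClusters (n : ℕ) (side : ℕ → Bool) (v : ℕ) : Finset (Finset (Fin n)) :=
  singletonClusters n ∪ ((Finset.Icc 2 v).image (cluster n side false) ∪
    (Finset.Icc 2 v).image (cluster n side true))

@[simp] lemma mem_cluster {n : ℕ} {side : ℕ → Bool} {s : Bool} {v : ℕ} {x : Fin n} :
    x ∈ cluster n side s v ↔ x.1 < v ∧ side x.1 = s := by simp [cluster]

lemma mem_currentClusters {n : ℕ} {side : ℕ → Bool} {v : ℕ} {X : Finset (Fin n)} :
    X ∈ currentClusters n side v ↔
      (∃ s, X = cluster n side s v) ∨ ∃ x : Fin n, v ≤ x.1 ∧ X = {x} := by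
  simp only [currentClusters, Finset.mem_insert, Finset.mem_image, Finset.mem_filter,
    Finset.mem_univ, true_and, Bool.exists_bool, or_assoc]
  simp only [eq_comm]

lemma mem_formedClusters {n : ℕ} {side : ℕ → Bool} {v : ℕ} {X : Finset (Fin n)} :
    X ∈ formedClusters n side v ↔
      X ∈ singletonClusters n ∨ ∃ s, ∃ u, 2 ≤ u ∧ u ≤ v ∧ X = cluster n side s u := by
  simp only [formedClusters, Finset.mem_union, Finset.mem_image, Finset.mem_Icc,
    Bool.exists_bool, and_assoc]
  simp only [eq_comm]

section Insertion

variable {n : ℕ} {side : ℕ → Bool}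

lemma cluster_succ_self (v : Fin n) :
    cluster n side (side v.1) (v.1 + 1) = {v} ∪ cluster n side (side v.1) v.1 := by
  ext x
  simp only [mem_cluster, Finset.mem_union, Finset.mem_singleton, Fin.ext_iff]
  constructor
  · rintro ⟨h1, h2⟩
    by_cases h : x.1 = v.1
    · exact Or.inl h
    · exact Or.inr ⟨by omega, h2⟩
  · rintro (h | ⟨h1, h2⟩)
    · exact ⟨by omega, by rw [h]⟩
    · exact ⟨by omega, h2⟩

lemma cluster_succ_of_ne (v : ℕ) {s : Bool} (hs : side v ≠ s) :
    cluster n side s (v + 1) = cluster n side s v := by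
  ext x
  simp only [mem_cluster]
  constructor
  · rintro ⟨h1, h2⟩
    refine ⟨lt_of_le_of_ne (by omega) fun h => hs (by rw [← h, h2]), h2⟩
  · rintro ⟨h1, h2⟩
    exact ⟨by omega, h2⟩

variable (hn : 2 ≤ n) (h0 : side 0 = false) (h1 : side 1 = true)
include hn h0 h1

lemma cluster_nonempty {v : ℕ} (hv : 2 ≤ v) (s : Bool) : (cluster n side s v).Nonempty := by
  cases s
  · exact ⟨⟨0, by omega⟩, by simp [h0]; omega⟩
  · exact ⟨⟨1, by omega⟩, by simp [h1]; omega⟩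

lemma cluster_two (s : Bool) :
    cluster n side s 2 = {⟨s.toNat, by cases s <;> simp <;> omega⟩} := by
  ext ⟨x, hx⟩
  simp only [mem_cluster, Finset.mem_singleton, Fin.mk.injEq]
  constructor
  · rintro ⟨hlt, hs⟩
    interval_cases x
    · rw [h0] at hs; subst hs; rfl
    · rw [h1] at hs; subst hs; rfl
  · rintro rfl
    cases s <;> simp [h0, h1]

lemma currentClusters_two : currentClusters n side 2 = singletonClusters n := by
  ext X
  rw [mem_currentClusters]
  simp only [singletonClusters, Finset.mem_image, Finset.mem_univ, true_and,
    cluster_two hn h0 h1]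
  constructor
  · rintro (⟨s, rfl⟩ | ⟨x, _, rfl⟩)
    · exact ⟨_, rfl⟩
    · exact ⟨_, rfl⟩
  · rintro ⟨x, rfl⟩
    by_cases hx : 2 ≤ x.1
    · exact Or.inr ⟨x, hx, rfl⟩
    · left
      by_cases hx0 : x.1 = 0
      · exact ⟨false, by simp [Fin.ext_iff, hx0]⟩
      · exact ⟨true, by simp [Fin.ext_iff]; omega⟩

lemma formedClusters_two : formedClusters n side 2 = singletonClusters n := by
  ext X
  rw [mem_formedClusters]
  constructor
  · rintro (h | ⟨s, u, hu, hu', rfl⟩)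
    · exact h
    · obtain rfl : u = 2 := by omega
      rw [cluster_two hn h0 h1]
      simp [singletonClusters]
  · exact Or.inl

omit hn h0 h1 in
lemma formedClusters_succ (v : Fin n) (hv : 2 ≤ v.1) :
    formedClusters n side (v.1 + 1) =
      insert ({v} ∪ cluster n side (side v.1) v.1) (formedClusters n side v.1) := by
  ext X
  rw [Finset.mem_insert, mem_formedClusters, mem_formedClusters]
  constructor
  · rintro (h | ⟨s, u, hu, hu', rfl⟩)
    · exact Or.inr (Or.inl h)
    · by_cases huv : u = v.1 + 1
      · subst huv
        by_cases hs : side v.1 = s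
        · subst hs
          exact Or.inl (cluster_succ_self v)
        · exact Or.inr (Or.inr ⟨s, v.1, hv, le_rfl, cluster_succ_of_ne _ hs⟩)
      · exact Or.inr (Or.inr ⟨s, u, hu, by omega, rfl⟩)
  · rintro (rfl | h | ⟨s, u, hu, hu', rfl⟩)
    · exact Or.inr ⟨side v.1, v.1 + 1, by omega, le_rfl, (cluster_succ_self v).symm⟩
    · exact Or.inl h
    · exact Or.inr ⟨s, u, hu, by omega, rfl⟩

lemma currentClusters_succ (v : Fin n) (hv : 2 ≤ v.1) :
    currentClusters n side (v.1 + 1) = insert ({v} ∪ cluster n side (side v.1) v.1)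
      (((currentClusters n side v.1).erase {v}).erase (cluster n side (side v.1) v.1)) := by
  have hvs : ∀ s, v ∉ cluster n side s v.1 := by simp
  have hsv : ∀ s, cluster n side s v.1 ≠ {v} := fun s h => hvs s (by rw [h]; simp)
  have hdiff : cluster n side (!side v.1) v.1 ≠ cluster n side (side v.1) v.1 := by
    intro h
    obtain ⟨x, hx⟩ := cluster_nonempty (n := n) hn h0 h1 hv (side v.1)
    have hx' := hx
    rw [← h] at hx'
    rw [mem_cluster] at hx hx'
    have := hx.2.symm.trans hx'.2
    cases hh : side v.1 <;> simp [hh] at this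
  ext X
  rw [Finset.mem_insert, Finset.mem_erase, Finset.mem_erase, mem_currentClusters,
    mem_currentClusters]
  constructor
  · rintro (⟨s, rfl⟩ | ⟨x, hx, rfl⟩)
    · by_cases hs : side v.1 = s
      · subst hs
        exact Or.inl (cluster_succ_self v)
      · have hs' : s = !side v.1 := by cases s <;> cases hh : side v.1 <;> simp_all
        subst hs'
        rw [cluster_succ_of_ne _ hs]
        exact Or.inr ⟨hdiff, hsv _, Or.inl ⟨_, rfl⟩⟩
    · refine Or.inr ⟨?_, ?_, Or.inr ⟨x, by omega, rfl⟩⟩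
      · intro h
        have : x ∈ cluster n side (side v.1) v.1 := by rw [← h]; simp
        rw [mem_cluster] at this
        omega
      · simp only [ne_eq, Finset.singleton_inj, Fin.ext_iff]
        omega
  · rintro (rfl | ⟨hX1, hX2, ⟨s, rfl⟩ | ⟨x, hx, rfl⟩⟩)
    · exact Or.inl ⟨_, (cluster_succ_self v).symm⟩
    · have hs : side v.1 ≠ s := by
        rintro rfl
        exact hX1 rfl
      exact Or.inl ⟨s, (cluster_succ_of_ne _ hs).symm⟩
    · refine Or.inr ⟨x, ?_, rfl⟩
      have : x.1 ≠ v.1 := fun h => hX2 (by rw [Fin.ext h])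
      omega

end Insertion

/-- When the points below `v` have been inserted, merging `v` into the cluster of its colour is
strictly better than every other merge. -/
def InsertionIsBest {n : ℕ} (V : ClusteringInstance n) (α : ℝ) (side : ℕ → Bool)
    (v : Fin n) : Prop :=
  ∀ X ∈ currentClusters n side v.1, ∀ Y ∈ currentClusters n side v.1, X ≠ Y →
    (X = {v} ∧ Y = cluster n side (side v.1) v.1) ∨
    (X = cluster n side (side v.1) v.1 ∧ Y = {v}) ∨
    avgPowLinkage V α {v} (cluster n side (side v.1) v.1) < avgPowLinkage V α X Y

section Dynamics

variable {n : ℕ} {side : ℕ → Bool} {V : ClusteringInstance n} {α : ℝ} {K : ℕ}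
  (h0 : side 0 = false) (h1 : side 1 = true)
  (hK : 2 ≤ K) (hKn : K ≤ n)
  (hbest : ∀ v : Fin n, 2 ≤ v.1 → v.1 < K → InsertionIsBest V α side v)
include h0 h1 hK hKn hbest

lemma linkageRun_insertion {v : ℕ} (hv : 2 ≤ v) (hvK : v ≤ K) :
    LinkageRun V α (currentClusters n side v) (formedClusters n side v) := by
  have hn : 2 ≤ n := hK.trans hKn
  induction v, hv using Nat.le_induction with
  | base =>
    rw [currentClusters_two hn h0 h1, formedClusters_two hn h0 h1]
    exact LinkageRun.start
  | succ v hv ih =>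
    have hb := hbest ⟨v, by omega⟩ hv (by simp; omega)
    have e1 := currentClusters_succ hn h0 h1 ⟨v, by omega⟩ hv
    have e2 := formedClusters_succ (side := side) (⟨v, by omega⟩ : Fin n) hv
    simp only at e1 e2
    rw [e1, e2]
    refine LinkageRun.merge (ih (by omega)) ?_ ?_ ?_ ?_
    · exact mem_currentClusters.2 (Or.inr ⟨_, le_rfl, rfl⟩)
    · exact mem_currentClusters.2 (Or.inl ⟨_, rfl⟩)
    · intro h
      have : (⟨v, by omega⟩ : Fin n) ∈ cluster n side (side v) v := by rw [← h]; simp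
      simp at this
    · intro X hX Y hY hXY
      rcases hb X hX Y hY hXY with ⟨rfl, rfl⟩ | ⟨rfl, rfl⟩ | h
      · exact le_rfl
      · exact (avgPowLinkage_comm _ _ _ _).le
      · exact h.le

omit hK hKn hbest in
/-- The only optimal merge inserts the next point. -/
lemma InsertionIsBest.merge_eq (v : Fin n) (hv : 2 ≤ v.1) (hb : InsertionIsBest V α side v)
    {A B : Finset (Fin n)} (hA : A ∈ currentClusters n side v.1)
    (hB : B ∈ currentClusters n side v.1) (hAB : A ≠ B)
    (hmin : ∀ X ∈ currentClusters n side v.1, ∀ Y ∈ currentClusters n side v.1, X ≠ Y →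
      avgPowLinkage V α A B ≤ avgPowLinkage V α X Y) :
    insert (A ∪ B) (((currentClusters n side v.1).erase A).erase B) =
        currentClusters n side (v.1 + 1) ∧
      insert (A ∪ B) (formedClusters n side v.1) = formedClusters n side (v.1 + 1) := by
  have hle := hmin {v} (mem_currentClusters.2 (Or.inr ⟨_, le_rfl, rfl⟩))
    (cluster n side (side v.1) v.1) (mem_currentClusters.2 (Or.inl ⟨_, rfl⟩)) (by
      intro h
      have : v ∈ cluster n side (side v.1) v.1 := by rw [← h]; simp
      simp at this)
  rw [currentClusters_succ (by omega) h0 h1 v hv, formedClusters_succ v hv]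
  rcases hb A hA B hB hAB with ⟨rfl, rfl⟩ | ⟨rfl, rfl⟩ | hlt
  · exact ⟨rfl, rfl⟩
  · rw [Finset.union_comm, Finset.erase_right_comm]
    exact ⟨rfl, rfl⟩
  · exact absurd hle (not_le.2 hlt)

/-- A run has no choice while points below `K` are inserted: it is at one of the intermediate
states, or it has passed all of them. -/
lemma LinkageRun.eq_or_formed_subset {P T : Finset (Finset (Fin n))} (h : LinkageRun V α P T) :
    (∃ v, 2 ≤ v ∧ v ≤ K ∧ P = currentClusters n side v ∧ T = formedClusters n side v) ∨
      formedClusters n side K ⊆ T := by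
  have hn : 2 ≤ n := hK.trans hKn
  induction h with
  | start =>
    exact Or.inl ⟨2, le_rfl, hK, (currentClusters_two hn h0 h1).symm,
      (formedClusters_two hn h0 h1).symm⟩
  | @merge P T A B _ hA hB hAB hmin ih =>
    rcases ih with ⟨v, hv, hvK, rfl, rfl⟩ | h
    · rcases hvK.eq_or_lt with rfl | hvK
      · exact Or.inr (Finset.subset_insert _ _)
      · have hvn : v < n := by omega
        exact Or.inl ⟨v + 1, by omega, by omega, InsertionIsBest.merge_eq h0 h1 ⟨v, hvn⟩ hv
          (hbest ⟨v, hvn⟩ hv hvK) hA hB hAB hmin⟩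
    · exact Or.inr (h.trans (Finset.subset_insert _ _))

omit h0 hbest in
lemma currentClusters_ne_univ {v : ℕ} :
    currentClusters n side v ≠ {Finset.univ} := by
  have hn : 2 ≤ n := hK.trans hKn
  intro h
  have hA : cluster n side false v ∈ currentClusters n side v :=
    mem_currentClusters.2 (Or.inl ⟨_, rfl⟩)
  rw [h, Finset.mem_singleton] at hA
  have : (⟨1, by omega⟩ : Fin n) ∈ cluster n side false v := by rw [hA]; simp
  simp [h1] at this

lemma IsMergeTree.formed_subset {T : Finset (Finset (Fin n))} (h : IsMergeTree V α T) :
    formedClusters n side K ⊆ T := by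
  rcases LinkageRun.eq_or_formed_subset h0 h1 hK hKn hbest h with ⟨v, _, _, hP, _⟩ | h
  · exact absurd hP.symm (currentClusters_ne_univ h1 hK hKn)
  · exact h

lemma IsMergeTree.cluster_mem {T : Finset (Finset (Fin n))} (h : IsMergeTree V α T) (s : Bool) :
    cluster n side s K ∈ T :=
  IsMergeTree.formed_subset h0 h1 hK hKn hbest h
    (mem_formedClusters.2 (Or.inr ⟨s, K, hK, le_rfl, rfl⟩))

end Dynamics

lemma currentClusters_self {n : ℕ} {side : ℕ → Bool} :
    currentClusters n side n = {cluster n side false n, cluster n side true n} := by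
  ext X
  rw [mem_currentClusters]
  simp only [Bool.exists_bool, Finset.mem_insert, Finset.mem_singleton, or_iff_left_iff_imp]
  rintro ⟨x, hx, _⟩
  omega

/-- If every point is inserted without a tie, then the merge tree is unique. -/
lemma isMergeTree_iff_of_insertionIsBest {n : ℕ} {side : ℕ → Bool} {V : ClusteringInstance n}
    {α : ℝ} (h0 : side 0 = false) (h1 : side 1 = true) (hn : 2 ≤ n)
    (hbest : ∀ v : Fin n, 2 ≤ v.1 → InsertionIsBest V α side v) (T : Finset (Finset (Fin n))) :
    IsMergeTree V α T ↔ T = insert Finset.univ (formedClusters n side n) := by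
  have hbest' : ∀ v : Fin n, 2 ≤ v.1 → v.1 < n → InsertionIsBest V α side v :=
    fun v hv _ => hbest v hv
  set A := cluster n side false n with hA
  set B := cluster n side true n with hB
  have hAB : A ≠ B := by
    intro h
    have : (⟨0, by omega⟩ : Fin n) ∈ B := by rw [← h]; simp [hA, h0]; omega
    simp [hB, h0] at this
  have hU : A ∪ B = Finset.univ := by
    ext x
    cases h : side x.1 <;> simp [hA, hB, h]
  have hcur : currentClusters n side n = {A, B} := currentClusters_self
  have herase : (({A, B} : Finset (Finset (Fin n))).erase A).erase B = ∅ := by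
    ext X; simp only [Finset.mem_erase, Finset.mem_insert, Finset.mem_singleton]
    simp; tauto
  have herase' : (({A, B} : Finset (Finset (Fin n))).erase B).erase A = ∅ := by
    rw [Finset.erase_right_comm, herase]
  constructor
  · intro h
    -- Beyond the last insertion a run has exactly one merge left, that of the two colour classes.
    have key : ∀ P T, LinkageRun V α P T →
        (∃ v, 2 ≤ v ∧ v ≤ n ∧ P = currentClusters n side v ∧ T = formedClusters n side v) ∨
          (P = {Finset.univ} ∧ T = insert Finset.univ (formedClusters n side n)) := by
      intro P T h
      induction h with
      | start =>
        exact Or.inl ⟨2, le_rfl, hn, (currentClusters_two hn h0 h1).symm,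
          (formedClusters_two hn h0 h1).symm⟩
      | @merge P T C D _ hC hD hCD hmin ih =>
        rcases ih with ⟨v, hv, hvn, rfl, rfl⟩ | ⟨rfl, rfl⟩
        · rcases hvn.eq_or_lt with rfl | hvn
          · right
            rw [hcur, Finset.mem_insert, Finset.mem_singleton] at hC hD
            rcases hC with rfl | rfl <;> rcases hD with rfl | rfl
            · exact absurd rfl hCD
            · rw [hcur, herase, hU]
              exact ⟨rfl, rfl⟩
            · rw [hcur, herase', Finset.union_comm, hU]
              exact ⟨rfl, rfl⟩
            · exact absurd rfl hCD
          · exact Or.inl ⟨v + 1, by omega, by omega, InsertionIsBest.merge_eq h0 h1 ⟨v, hvn⟩ hv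
              (hbest ⟨v, hvn⟩ hv) hC hD hCD hmin⟩
        · rw [Finset.mem_singleton] at hC hD
          exact absurd (hC.trans hD.symm) hCD
    rcases key _ _ h with ⟨v, _, _, hP, _⟩ | ⟨_, hT⟩
    · exact absurd hP.symm (currentClusters_ne_univ h1 hn le_rfl)
    · exact hT
  · rintro rfl
    have hrun := linkageRun_insertion h0 h1 hn le_rfl hbest' hn le_rfl
    rw [hcur] at hrun
    have := LinkageRun.merge hrun (A := A) (B := B) (by simp) (by simp) hAB (by
      intro X hX Y hY hXY
      simp only [Finset.mem_insert, Finset.mem_singleton] at hX hY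
      rcases hX with rfl | rfl <;> rcases hY with rfl | rfl
      · exact absurd rfl hXY
      · exact le_rfl
      · exact (avgPowLinkage_comm _ _ _ _).le
      · exact absurd rfl hXY)
    rw [hU, herase] at this
    exact this

/-! ### Bit patterns -/

/-- The colouring that encodes a set `T` of bits: in each pair `2t, 2t + 1` one point is sent to
each side, and `2t` is sent to `true` iff `t ∈ T`. -/
def pairSide (T : Finset ℕ) (x : ℕ) : Bool := decide (x / 2 ∈ T ↔ x % 2 = 0)

lemma pairSide_even (T : Finset ℕ) (t : ℕ) : pairSide T (2 * t) = decide (t ∈ T) := by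
  have h1 : 2 * t / 2 = t := by omega
  have h2 : 2 * t % 2 = 0 := by omega
  simp [pairSide, h1, h2]

lemma pairSide_odd (T : Finset ℕ) (t : ℕ) : pairSide T (2 * t + 1) = !decide (t ∈ T) := by
  have h1 : (2 * t + 1) / 2 = t := by omega
  have h2 : (2 * t + 1) % 2 = 1 := by omega
  simp [pairSide, h1, h2]

/-- The sign of bit `t`. -/
def bitSign (T : Finset ℕ) (t : ℕ) : ℝ := if t ∈ T then 1 else -1

/-- The real number with signed binary digits `bitSign T`. -/
noncomputable def bitCode (n : ℕ) (T : Finset ℕ) : ℝ :=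
  ∑ t ∈ Finset.Ico 2 n, bitSign T t * (1 / 2) ^ t

lemma abs_sum_bitSign_le (T : Finset ℕ) {m n : ℕ} (h : m ≤ n) :
    |∑ t ∈ Finset.Ico m n, bitSign T t * (1 / 2 : ℝ) ^ t| ≤ 2 * (1 / 2) ^ m - 2 * (1 / 2) ^ n := by
  induction n, h using Nat.le_induction with
  | base => simp
  | succ n h ih =>
    rw [Finset.sum_Ico_succ_top h]
    have : |bitSign T n * (1 / 2 : ℝ) ^ n| = (1 / 2) ^ n := by
      rw [abs_mul, abs_of_pos (a := (1 / 2 : ℝ) ^ n) (by positivity)]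
      unfold bitSign
      split_ifs <;> simp
    refine (abs_add_le _ _).trans ?_
    rw [this, pow_succ]
    linarith

/-- The remainder of a signed binary expansion from digit `t` on has the sign of that digit. -/
lemma bitSign_mul_sum_pos (T : Finset ℕ) {t n : ℕ} (h : t < n) :
    0 < bitSign T t * ∑ u ∈ Finset.Ico t n, bitSign T u * (1 / 2 : ℝ) ^ u := by
  rw [Finset.sum_eq_sum_Ico_succ_bot h, mul_add]
  have hb := abs_le.1 (abs_sum_bitSign_le T (show t + 1 ≤ n from h))
  have h1 : (0 : ℝ) < (1 / 2) ^ n := by positivity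
  rw [pow_succ] at hb
  have h2 : bitSign T t = 1 ∨ bitSign T t = -1 := by
    unfold bitSign
    split_ifs <;> simp
  rcases h2 with h2 | h2 <;> rw [h2] <;> linarith

lemma abs_bitCode_le (n : ℕ) (hn : 2 ≤ n) (T : Finset ℕ) : |bitCode n T| ≤ 1 := by
  refine (abs_sum_bitSign_le T hn).trans ?_
  have h1 : (0 : ℝ) < (1 / 2) ^ n := by positivity
  have h2 : 2 * (1 / 2 : ℝ) ^ 2 ≤ 1 := by norm_num
  linarith

/-! ### Sums over the clusters -/

section ClusterSum

variable {n : ℕ} {side : ℕ → Bool}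

lemma sum_cluster_zero (s : Bool) (f : ℕ → ℝ) : ∑ x ∈ cluster n side s 0, f x.1 = 0 := by
  have : cluster n side s 0 = ∅ := by ext x; simp
  rw [this, Finset.sum_empty]

lemma sum_cluster_succ {v : ℕ} (hv : v < n) (s : Bool) (f : ℕ → ℝ) :
    ∑ x ∈ cluster n side s (v + 1), f x.1 =
      ∑ x ∈ cluster n side s v, f x.1 + if side v = s then f v else 0 := by
  by_cases hs : side v = s
  · subst hs
    have := cluster_succ_self (side := side) (⟨v, hv⟩ : Fin n)
    simp only at this
    rw [this, Finset.sum_union (by simp)]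
    simp [add_comm]
  · rw [cluster_succ_of_ne _ hs, if_neg hs, add_zero]

lemma sum_cluster_four {T : Finset ℕ} (h0 : 0 ∉ T) (h1 : 1 ∉ T) (hn : 4 ≤ n) (s : Bool)
    (f : ℕ → ℝ) : ∑ x ∈ cluster n (pairSide T) s 4, f x.1 =
      f s.toNat + f (s.toNat + 2) := by
  rw [sum_cluster_succ (by omega), sum_cluster_succ (by omega), sum_cluster_succ (by omega),
    sum_cluster_succ (by omega), sum_cluster_zero]
  cases s <;> simp [pairSide, h0, h1]

/-- The two clusters contain one point of each pair. -/
lemma sum_cluster_sub_sum_cluster (T : Finset ℕ) (f : ℕ → ℝ) (t : ℕ) (ht : 2 * t ≤ n) :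
    ∑ x ∈ cluster n (pairSide T) false (2 * t), f x.1 -
      ∑ x ∈ cluster n (pairSide T) true (2 * t), f x.1 =
      ∑ u ∈ Finset.range t, bitSign T u * (f (2 * u + 1) - f (2 * u)) := by
  induction t with
  | zero => simp [sum_cluster_zero]
  | succ t ih =>
    rw [Finset.sum_range_succ, ← ih (by omega), show 2 * (t + 1) = 2 * t + 1 + 1 by ring]
    simp only [sum_cluster_succ (show 2 * t + 1 < n by omega),
      sum_cluster_succ (show 2 * t < n by omega), pairSide_even, pairSide_odd, bitSign]
    by_cases h : t ∈ T <;> simp [h] <;> ring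

lemma card_cluster_even (T : Finset ℕ) (s : Bool) (t : ℕ) (ht : 2 * t ≤ n) :
    ((cluster n (pairSide T) s (2 * t)).card : ℝ) = t := by
  have key : ∑ x ∈ cluster n (pairSide T) s (2 * t), (fun _ : ℕ => (1 : ℝ)) x.1 = t := by
    induction t with
    | zero => simpa using sum_cluster_zero s (fun _ => (1 : ℝ))
    | succ t ih =>
      rw [show 2 * (t + 1) = 2 * t + 1 + 1 by ring]
      simp only [sum_cluster_succ (show 2 * t + 1 < n by omega) s (fun _ => (1 : ℝ)),
        sum_cluster_succ (show 2 * t < n by omega) s (fun _ => (1 : ℝ)), pairSide_even,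
        pairSide_odd, ih (by omega)]
      by_cases h : t ∈ T <;> cases s <;> simp [h]
  simpa using key

end ClusterSum

/-! ### The squared distances -/

/-- The scale of the point `y`: it increases slowly with `y`, which makes the linkage procedure
insert the points in their order. -/
noncomputable def level (n y : ℕ) : ℝ := 1 + (y : ℝ) / (n : ℝ) ^ 3

/-- The gap of `∑ x log x` over the squared distances of a point of scale `level n y` to the
anchors `0, 2` and to the anchors `1, 3`; as the two pairs have the same sum, it is the derivative
in the exponent of the difference of the power sums. -/
noncomputable def anchorGap (n y : ℕ) : ℝ :=
  4 / 5 * Real.log (4 / 5) + (2 * level n y - 4 / 5) * Real.log (2 * level n y - 4 / 5) -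
    (9 / 10 * Real.log (9 / 10) + (2 * level n y - 9 / 10) * Real.log (2 * level n y - 9 / 10))

/-- The unperturbed squared distance of the points `x < y`. The points `K ≤ y` are far from all
others. The anchors `0, 2` have the same sum of squared distances to a point `4 ≤ y < K` as the
anchors `1, 3`; the points of a pair `2t, 2t + 1` repel each other. The marked point `2j + 1` is
slightly further away from the anchor `1` than the other points are; for `j ≤ 1` no point is marked.
The anchor distances are chosen such that `0, 2` merge before `1, 3`, and both before any other
point is inserted. The ratio of two squared distances of core points is less than four. -/
noncomputable def baseSq (n K j x y : ℕ) : ℝ :=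
  if K ≤ y then (4 * (n : ℝ) + 4) ^ 2
  else if y < 4 then
    if y = x + 2 then (if x = 0 then 3 / 5 else 7 / 10) else 2
  else if x = 0 then 4 / 5
  else if x = 1 then (if y = 2 * j + 1 then 19 / 20 else 9 / 10)
  else if x = 2 then 2 * level n y - 4 / 5
  else if x = 3 then 2 * level n y - (if y = 2 * j + 1 then 19 / 20 else 9 / 10)
  else if y % 2 = 1 ∧ y = x + 1 then 2
  else level n y

/-- The direction in which the squared distance of the points `x < y` is perturbed; the even points
remember the earlier even points with binary weights. -/
noncomputable def pertSq (n K x y : ℕ) : ℝ :=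
  if y < K ∧ 4 ≤ x ∧ x % 2 = 0 ∧ y % 2 = 0 then anchorGap n y * (1 / 2) ^ (x / 2) else 0

/-- The squared distance, with perturbation of size `ε`. -/
noncomputable def sqDist (n K j : ℕ) (ε : ℝ) (x y : ℕ) : ℝ :=
  baseSq n K j (min x y) (max x y) + ε * pertSq n K (min x y) (max x y)

lemma sqDist_comm (n K j : ℕ) (ε : ℝ) (x y : ℕ) : sqDist n K j ε x y = sqDist n K j ε y x := by
  unfold sqDist
  rw [min_comm, max_comm]

lemma sqDist_of_lt (n K j : ℕ) (ε : ℝ) {x y : ℕ} (h : x < y) :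
    sqDist n K j ε x y = baseSq n K j x y + ε * pertSq n K x y := by
  unfold sqDist
  rw [min_eq_left h.le, max_eq_right h.le]

section Level

variable {n : ℕ}

lemma one_le_level (n y : ℕ) : 1 ≤ level n y := by
  unfold level
  have : 0 ≤ (y : ℝ) / (n : ℝ) ^ 3 := by positivity
  linarith

lemma level_lt_level (hn : 0 < n) {y z : ℕ} (h : y < z) : level n y < level n z := by
  unfold level
  have : (y : ℝ) < z := by exact_mod_cast h
  have : (0 : ℝ) < (n : ℝ) ^ 3 := by positivity
  gcongr

lemma level_sub_one_mul_sq_le (hn : 0 < n) {y : ℕ} (h : y ≤ n) :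
    (level n y - 1) * (n : ℝ) ^ 2 ≤ 1 := by
  have hn' : (0 : ℝ) < n := by exact_mod_cast hn
  have h' : (y : ℝ) ≤ n := by exact_mod_cast h
  have : (level n y - 1) * (n : ℝ) ^ 2 = y / n := by
    unfold level
    field_simp
    ring
  rw [this]
  exact (div_le_one hn').2 h'

lemma level_le (hn : 4 ≤ n) {y : ℕ} (h : y ≤ n) : level n y ≤ 17 / 16 := by
  have h1 := level_sub_one_mul_sq_le (by omega) h
  have h2 : (4 : ℝ) ≤ n := by exact_mod_cast hn
  have h3 := one_le_level n y
  nlinarith [mul_nonneg (sub_nonneg.2 h3) (by nlinarith : (0 : ℝ) ≤ (n : ℝ) ^ 2 - 16)]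

lemma anchorGap_pos (n y : ℕ) : 0 < anchorGap n y := by
  have hL := one_le_level n y
  set L := level n y with hLdef
  set l : ℝ := (2 * L - 17 / 10) / (2 * L - 8 / 5) with hl
  have hd : 0 < 2 * L - 8 / 5 := by linarith
  have hl0 : 0 < l := div_pos (by linarith) hd
  have hl1 : 0 < 1 - l := by
    rw [hl, sub_pos, div_lt_one hd]
    linarith
  have hld : l * (2 * L - 8 / 5) = 2 * L - 17 / 10 := div_mul_cancel₀ _ hd.ne'
  have hc := Real.strictConvexOn_mul_log
  have h1 := hc.2 (x := 4 / 5) (by norm_num : (0 : ℝ) ≤ 4 / 5) (y := 2 * L - 4 / 5)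
    (show (0 : ℝ) ≤ 2 * L - 4 / 5 by linarith) (by intro h; linarith) hl0 hl1 (by ring)
  have h2 := hc.2 (x := 2 * L - 4 / 5) (show (0 : ℝ) ≤ 2 * L - 4 / 5 by linarith) (y := 4 / 5)
    (by norm_num : (0 : ℝ) ≤ 4 / 5) (by intro h; linarith) hl0 hl1 (by ring)
  simp only [smul_eq_mul] at h1 h2
  rw [show l * (4 / 5) + (1 - l) * (2 * L - 4 / 5) = 9 / 10 by linear_combination -hld] at h1
  rw [show l * (2 * L - 4 / 5) + (1 - l) * (4 / 5) = 2 * L - 9 / 10 by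
    linear_combination hld] at h2
  unfold anchorGap
  rw [← hLdef]
  linarith

end Level

section Base

variable {n K j : ℕ}

lemma baseSq_far {x y : ℕ} (h : K ≤ y) : baseSq n K j x y = (4 * (n : ℝ) + 4) ^ 2 := by
  simp [baseSq, h]

lemma sixteen_le_far (n : ℕ) : (16 : ℝ) ≤ (4 * (n : ℝ) + 4) ^ 2 := by
  have : (0 : ℝ) ≤ n := by positivity
  nlinarith

lemma baseSq_lower (x y : ℕ) :
    3 / 5 ≤ baseSq n K j x y ∧ ((x = 0 ∧ y = 2) ∨ 7 / 10 ≤ baseSq n K j x y) ∧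
      ((x = 0 ∧ y = 2) ∨ (x = 1 ∧ y = 3) ∨ 4 / 5 ≤ baseSq n K j x y) := by
  have h1 := one_le_level n y
  have h2 := sixteen_le_far n
  unfold baseSq
  split_ifs <;> refine ⟨by linarith, ?_, ?_⟩ <;>
    first
      | exact Or.inr (by linarith)
      | exact Or.inr (Or.inr (by linarith))
      | (left; omega)
      | (right; left; omega)

lemma baseSq_le_two (hn : 4 ≤ n) (hKn : K ≤ n) {x y : ℕ} (hy : y < K) :
    baseSq n K j x y ≤ 2 := by
  have h2 := level_le hn (hy.le.trans hKn)
  unfold baseSq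
  split_ifs <;> first | omega | linarith

lemma baseSq_pos (x y : ℕ) : 0 < baseSq n K j x y :=
  lt_of_lt_of_le (by norm_num) (baseSq_lower x y).1

lemma level_le_baseSq {x y : ℕ} (hn : 4 ≤ n) (hKn : K ≤ n) (hx : 4 ≤ x) (h : x < y) (hy : y < K) :
    level n y ≤ baseSq n K j x y := by
  have h2 := level_le hn (hy.le.trans hKn)
  unfold baseSq
  split_ifs <;> first | omega | linarith

/-- The total excess of the squared distances of `w` to a cluster over the scale of `w`: only the
partner of `w` contributes. -/
lemma sum_cluster_baseSq_sub_level {T : Finset ℕ} (h0 : 0 ∉ T) (h1 : 1 ∉ T) (hKn : K ≤ n)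
    {v w : ℕ} (hv : 4 ≤ v) (hvw : v ≤ w) (hw : w < K) (s : Bool) :
    ∑ x ∈ cluster n (pairSide T) s v, (baseSq n K j x.1 w - level n w) =
      if w % 2 = 1 ∧ v = w ∧ pairSide T w ≠ s then 2 - level n w else 0 := by
  induction v, hv using Nat.le_induction with
  | base =>
    rw [sum_cluster_four h0 h1 (by omega) s (fun x => baseSq n K j x w - level n w), if_neg]
    · have h2 : ¬ K ≤ w := by omega
      have h3 : ¬ w < 4 := by omega
      cases s <;> simp [baseSq, h2, h3] <;> ring
    · rintro ⟨h2, h3, _⟩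
      omega
  | succ v hv ih =>
    rw [sum_cluster_succ (by omega) s (fun x => baseSq n K j x w - level n w), ih (by omega),
      if_neg (by omega), zero_add]
    have e : baseSq n K j v w = if w % 2 = 1 ∧ w = v + 1 then 2 else level n w := by
      have h2 : ¬ K ≤ w := by omega
      have h3 : ¬ w < 4 := by omega
      have h4 : v ≠ 0 := by omega
      have h5 : v ≠ 1 := by omega
      have h6 : v ≠ 2 := by omega
      have h7 : v ≠ 3 := by omega
      simp [baseSq, h2, h3, h4, h5, h6, h7]
    rw [e]
    by_cases hw1 : w % 2 = 1 ∧ w = v + 1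
    · obtain ⟨hw1, rfl⟩ := hw1
      obtain ⟨u, rfl⟩ : ∃ u, v = 2 * u := ⟨v / 2, by omega⟩
      simp only [pairSide_even, pairSide_odd, hw1]
      by_cases h : u ∈ T <;> cases s <;> simp [h]
    · have hw2 : ¬ (w % 2 = 1 ∧ v + 1 = w ∧ pairSide T w ≠ s) :=
        fun h => hw1 ⟨h.1, h.2.1.symm⟩
      rw [if_neg hw1, if_neg hw2]
      simp

/-- The total of the squared distances between the two clusters exceeds the number of pairs of
points, since the anchors repel each other. -/
lemma four_le_sum_cross {T : Finset ℕ} (h0 : 0 ∉ T) (h1 : 1 ∉ T) (hn : 4 ≤ n) (hKn : K ≤ n)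
    {v : ℕ} (hv : 4 ≤ v) (hvK : v ≤ K) :
    4 ≤ ∑ x ∈ cluster n (pairSide T) false v, ∑ y ∈ cluster n (pairSide T) true v,
      (sqDist n K j 0 x.1 y.1 - 1) := by
  induction v, hv using Nat.le_induction with
  | base =>
    rw [sum_cluster_four h0 h1 hn false
      (fun x => ∑ y ∈ cluster n (pairSide T) true 4, (sqDist n K j 0 x y.1 - 1))]
    rw [sum_cluster_four h0 h1 hn true (fun y => sqDist n K j 0 _ y - 1),
      sum_cluster_four h0 h1 hn true (fun y => sqDist n K j 0 _ y - 1)]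
    have h : ¬ K ≤ 1 := by omega
    have h' : ¬ K ≤ 2 := by omega
    have h'' : ¬ K ≤ 3 := by omega
    simp [sqDist, baseSq, h, h', h'']
    norm_num
  | succ v hv ih =>
    have hpos : ∀ s, 0 ≤ ∑ x ∈ cluster n (pairSide T) s v, (sqDist n K j 0 x.1 v - 1) := by
      intro s
      have := sum_cluster_baseSq_sub_level (j := j) h0 h1 hKn hv le_rfl (show v < K by omega) s
      have h2 := level_le hn (show v ≤ n by omega)
      have h3 : 0 ≤ ∑ x ∈ cluster n (pairSide T) s v, (baseSq n K j x.1 v - level n v) := by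
        rw [this]
        split_ifs <;> linarith
      refine h3.trans (Finset.sum_le_sum fun x hx => ?_)
      rw [sqDist_of_lt _ _ _ _ (mem_cluster.1 hx).1]
      linarith [one_le_level n v]
    have ih' := ih (by omega)
    have hvn : v < n := by omega
    cases hs : pairSide T v
    · rw [cluster_succ_of_ne v (s := true) (by simp [hs]), sum_cluster_succ hvn false
        (fun x => ∑ y ∈ cluster n (pairSide T) true v, (sqDist n K j 0 x y.1 - 1)), if_pos hs]
      have := hpos true
      simp_rw [sqDist_comm n K j 0 _ v] at this
      linarith
    · rw [cluster_succ_of_ne v (s := false) (by simp [hs])]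
      rw [Finset.sum_comm, sum_cluster_succ hvn true
        (fun y => ∑ x ∈ cluster n (pairSide T) false v, (sqDist n K j 0 x.1 y - 1)), if_pos hs,
        Finset.sum_comm]
      have := hpos false
      linarith

end Base

/-! ### Average linkage at the unperturbed distances -/

/-- Average linkage with exponent `2 + 2 ε b` for the distances whose squares are `sqDist`. -/
noncomputable def sqLinkage (n K j : ℕ) (b ε : ℝ) (X Y : Finset (Fin n)) : ℝ :=
  (∑ x ∈ X, ∑ y ∈ Y, sqDist n K j ε x.1 y.1 ^ (1 + ε * b)) / ((X.card : ℝ) * (Y.card : ℝ))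

lemma sqLinkage_comm (n K j : ℕ) (b ε : ℝ) (X Y : Finset (Fin n)) :
    sqLinkage n K j b ε X Y = sqLinkage n K j b ε Y X := by
  unfold sqLinkage
  rw [Finset.sum_comm, mul_comm (X.card : ℝ)]
  simp_rw [sqDist_comm n K j ε]

lemma sqLinkage_zero (n K j : ℕ) (b : ℝ) (X Y : Finset (Fin n)) :
    sqLinkage n K j b 0 X Y =
      (∑ x ∈ X, ∑ y ∈ Y, sqDist n K j 0 x.1 y.1) / ((X.card : ℝ) * (Y.card : ℝ)) := by
  simp [sqLinkage]

section Zeroth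

variable {n K j : ℕ} {b : ℝ} {X Y : Finset (Fin n)}

lemma sqLinkage_zero_sub (hX : X.Nonempty) (hY : Y.Nonempty) (m : ℝ) :
    sqLinkage n K j b 0 X Y - m =
      (∑ x ∈ X, ∑ y ∈ Y, (sqDist n K j 0 x.1 y.1 - m)) / ((X.card : ℝ) * (Y.card : ℝ)) := by
  have hX' : (X.card : ℝ) ≠ 0 := by exact_mod_cast hX.card_pos.ne'
  have hY' : (Y.card : ℝ) ≠ 0 := by exact_mod_cast hY.card_pos.ne'
  rw [sqLinkage_zero]
  simp only [Finset.sum_sub_distrib, Finset.sum_const, nsmul_eq_mul]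
  field_simp

lemma lt_sqLinkage_zero (hX : X.Nonempty) (hY : Y.Nonempty) {m : ℝ}
    (h : 0 < ∑ x ∈ X, ∑ y ∈ Y, (sqDist n K j 0 x.1 y.1 - m)) :
    m < sqLinkage n K j b 0 X Y := by
  rw [← sub_pos, sqLinkage_zero_sub hX hY]
  have hX' : (0 : ℝ) < X.card := by exact_mod_cast hX.card_pos
  have hY' : (0 : ℝ) < Y.card := by exact_mod_cast hY.card_pos
  positivity

lemma lt_sqLinkage_zero_of_forall (hX : X.Nonempty) (hY : Y.Nonempty) {m : ℝ}
    (h : ∀ x ∈ X, ∀ y ∈ Y, m < sqDist n K j 0 x.1 y.1) : m < sqLinkage n K j b 0 X Y :=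
  lt_sqLinkage_zero hX hY (Finset.sum_pos (fun x hx =>
    Finset.sum_pos (fun y hy => sub_pos.2 (h x hx y hy)) hY) hX)

end Zeroth

/-- The unperturbed linkage at which the point `v` is inserted. -/
noncomputable def insertionValue (n v : ℕ) : ℝ :=
  if v = 2 then 3 / 5 else if v = 3 then 7 / 10 else level n v

lemma sqDist_zero (n K j x y : ℕ) :
    sqDist n K j 0 x y = baseSq n K j (min x y) (max x y) := by
  simp [sqDist]

section Pattern

variable {T : Finset ℕ} (h0 : 0 ∉ T) (h1 : 1 ∉ T)
include h0 h1

lemma pairSide_zero_to_three : pairSide T 0 = false ∧ pairSide T 1 = true ∧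
    pairSide T 2 = false ∧ pairSide T 3 = true := by
  simp [pairSide, h0, h1]

variable {n K : ℕ} (j : ℕ) (b : ℝ) (hn : 4 ≤ n) (hKn : K ≤ n)

omit h0 h1 in
lemma insertionValue_lt_of_lt_four {v : ℕ} (hv : v = 2 ∨ v = 3) {x y : ℕ}
    (hxy : ¬ (min x y = v - 2 ∧ max x y = v)) (h3 : v = 3 → ¬ (min x y = 0 ∧ max x y = 2)) :
    insertionValue n v < sqDist n K j 0 x y := by
  have h := baseSq_lower (n := n) (K := K) (j := j) (min x y) (max x y)
  rw [sqDist_zero]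
  unfold insertionValue
  rcases hv with rfl | rfl
  · rcases h.2.1 with h | h
    · exact absurd h hxy
    · norm_num
      linarith
  · rcases h.2.2 with h | h | h
    · exact absurd h (h3 rfl)
    · exact absurd h hxy
    · norm_num
      linarith

include hn hKn

omit hn in
lemma sum_singleton_cluster {v w : Fin n} (hv : 4 ≤ v.1) (hvw : v.1 ≤ w.1) (hw : w.1 < K)
    (s : Bool) (m : ℝ) :
    ∑ x ∈ ({w} : Finset (Fin n)), ∑ y ∈ cluster n (pairSide T) s v.1,
      (sqDist n K j 0 x.1 y.1 - m) =
      (if w.1 % 2 = 1 ∧ v.1 = w.1 ∧ pairSide T w.1 ≠ s then 2 - level n w.1 else 0) +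
        (cluster n (pairSide T) s v.1).card * (level n w.1 - m) := by
  rw [Finset.sum_singleton,
    ← sum_cluster_baseSq_sub_level (j := j) h0 h1 hKn hv hvw hw s, ← nsmul_eq_mul,
    ← Finset.sum_const, ← Finset.sum_add_distrib]
  refine Finset.sum_congr rfl fun y hy => ?_
  have hlt : y.1 < w.1 := lt_of_lt_of_le (mem_cluster.1 hy).1 hvw
  rw [sqDist_comm, sqDist_zero, min_eq_left hlt.le, max_eq_right hlt.le]
  ring

lemma sqLinkage_zero_insertion {v : Fin n} (hv : 2 ≤ v.1) (hvK : v.1 < K) :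
    sqLinkage n K j b 0 {v} (cluster n (pairSide T) (pairSide T v.1) v.1) =
      insertionValue n v.1 := by
  obtain ⟨s0, s1, s2, s3⟩ := pairSide_zero_to_three h0 h1
  have hne : (cluster n (pairSide T) (pairSide T v.1) v.1).Nonempty :=
    cluster_nonempty (by omega) s0 s1 hv _
  by_cases hv4 : 4 ≤ v.1
  · rw [← sub_eq_zero, sqLinkage_zero_sub (by simp) hne,
      sum_singleton_cluster h0 h1 j hKn hv4 le_rfl hvK]
    have : insertionValue n v.1 = level n v.1 := by
      unfold insertionValue
      rw [if_neg (by omega), if_neg (by omega)]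
    simp [this]
  · have key : ∀ u : Fin n, u.1 + 2 = v.1 →
        cluster n (pairSide T) (pairSide T v.1) v.1 = {u} := by
      intro u hu
      ext x
      simp only [mem_cluster, Finset.mem_singleton, Fin.ext_iff]
      constructor
      · rintro ⟨hx, hs⟩
        have : v.1 = 2 ∨ v.1 = 3 := by omega
        have : x.1 = 0 ∨ x.1 = 1 ∨ x.1 = 2 := by omega
        rcases ‹v.1 = 2 ∨ v.1 = 3› with h | h <;> rcases this with h' | h' | h' <;>
          simp_all
      · intro hx
        have : v.1 = 2 ∨ v.1 = 3 := by omega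
        rcases this with h | h
        · have hu0 : u.1 = 0 := by omega
          rw [hx, hu0, h, s0, s2]
          simp
        · have hu0 : u.1 = 1 := by omega
          rw [hx, hu0, h, s1, s3]
          simp
    rw [key ⟨v.1 - 2, by omega⟩ (by simp; omega), sqLinkage_zero]
    simp only [Finset.sum_singleton, Finset.card_singleton, Nat.cast_one, mul_one, div_one]
    rw [sqDist_zero, min_eq_right (by omega), max_eq_left (by omega)]
    have : v.1 = 2 ∨ v.1 = 3 := by omega
    rcases this with h | h <;> rw [h] at hvK ⊢ <;>
      simp [baseSq, insertionValue, not_le.2 hvK]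

lemma insertionValue_lt_cross {v : Fin n} (hv : 2 ≤ v.1) (hvK : v.1 < K) :
    insertionValue n v.1 < sqLinkage n K j b 0 (cluster n (pairSide T) false v.1)
      (cluster n (pairSide T) true v.1) := by
  obtain ⟨s0, s1, s2, s3⟩ := pairSide_zero_to_three h0 h1
  have hne : ∀ s, (cluster n (pairSide T) s v.1).Nonempty :=
    cluster_nonempty (by omega) s0 s1 hv
  by_cases hv4 : 4 ≤ v.1
  · have e : insertionValue n v.1 = level n v.1 := by
      unfold insertionValue
      rw [if_neg (by omega), if_neg (by omega)]
    rw [e]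
    apply lt_sqLinkage_zero (hne _) (hne _)
    have hc := four_le_sum_cross (j := j) h0 h1 hn hKn hv4 hvK.le
    simp only [Finset.sum_sub_distrib, Finset.sum_const, nsmul_eq_mul, mul_one] at hc ⊢
    have hA : ((cluster n (pairSide T) false v.1).card : ℝ) ≤ n := by
      exact_mod_cast (Finset.card_le_univ _).trans (by simp)
    have hB : ((cluster n (pairSide T) true v.1).card : ℝ) ≤ n := by
      exact_mod_cast (Finset.card_le_univ _).trans (by simp)
    have hL := level_sub_one_mul_sq_le (show 0 < n by omega) (show v.1 ≤ n by omega)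
    have hL1 := one_le_level n v.1
    have hAB : ((cluster n (pairSide T) false v.1).card : ℝ) *
        (cluster n (pairSide T) true v.1).card ≤ (n : ℝ) ^ 2 := by
      rw [sq]
      gcongr
    have := mul_le_mul_of_nonneg_left hAB (sub_nonneg.2 hL1)
    nlinarith
  · apply lt_sqLinkage_zero_of_forall (hne _) (hne _)
    intro x hx y hy
    rw [mem_cluster] at hx hy
    apply insertionValue_lt_of_lt_four j (by omega)
    · rintro ⟨_, h⟩
      omega
    · rintro h3 ⟨hm, hM⟩
      have hxy : (x.1 = 0 ∧ y.1 = 2) ∨ (x.1 = 2 ∧ y.1 = 0) := by omega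
      rcases hxy with ⟨_, h⟩ | ⟨_, h⟩
      · rw [h, s2] at hy
        simp at hy
      · rw [h, s0] at hy
        simp at hy

/-- Merging a point into a cluster is worse than the intended insertion, unless it is the insertion
of an even point on the wrong side, which is equally good before the perturbation. -/
lemma insertionValue_lt_singleton_cluster {v w : Fin n} (hv : 2 ≤ v.1)
    (hvw : v.1 ≤ w.1) {s : Bool}
    (hs : w = v → s ≠ pairSide T v.1 ∧ ¬ (4 ≤ v.1 ∧ v.1 % 2 = 0)) :
    insertionValue n v.1 < sqLinkage n K j b 0 {w} (cluster n (pairSide T) s v.1) := by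
  obtain ⟨s0, s1, s2, s3⟩ := pairSide_zero_to_three h0 h1
  have hne : (cluster n (pairSide T) s v.1).Nonempty :=
    cluster_nonempty (by omega) s0 s1 hv _
  by_cases hv4 : 4 ≤ v.1
  · have e : insertionValue n v.1 = level n v.1 := by
      unfold insertionValue
      rw [if_neg (by omega), if_neg (by omega)]
    rw [e]
    have hLv := level_le hn (show v.1 ≤ n by omega)
    by_cases hwK : w.1 < K
    · apply lt_sqLinkage_zero (by simp) hne
      rw [sum_singleton_cluster h0 h1 j hKn hv4 hvw hwK]
      have hcard : (0 : ℝ) < (cluster n (pairSide T) s v.1).card := by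
        exact_mod_cast hne.card_pos
      have hLw := level_le hn (show w.1 ≤ n by omega)
      rcases hvw.eq_or_lt with h | h
      · obtain ⟨hs1, hs2⟩ := hs (Fin.ext h.symm)
        rw [if_pos ⟨by omega, h, by rw [← h]; exact hs1.symm⟩, h]
        linarith
      · have := level_lt_level (show 0 < n by omega) h
        have := mul_pos hcard (sub_pos.2 this)
        split_ifs <;> linarith
    · apply lt_sqLinkage_zero_of_forall (by simp) hne
      intro x hx y hy
      rw [Finset.mem_singleton] at hx
      subst hx
      rw [sqDist_zero, baseSq_far (le_trans (not_lt.1 hwK) (le_max_left _ _))]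
      linarith [sixteen_le_far n]
  · apply lt_sqLinkage_zero_of_forall (by simp) hne
    intro x hx y hy
    rw [Finset.mem_singleton] at hx
    subst hx
    rw [mem_cluster] at hy
    apply insertionValue_lt_of_lt_four j (by omega)
    · rintro ⟨hm, hM⟩
      have hxv : x = v := Fin.ext (by omega)
      apply (hs hxv).1
      rw [← hy.2]
      have : (v.1 = 2 ∧ y.1 = 0) ∨ (v.1 = 3 ∧ y.1 = 1) := by omega
      rcases this with ⟨h, h'⟩ | ⟨h, h'⟩ <;> rw [h, h']
      · rw [s0, s2]
      · rw [s1, s3]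
    · rintro h3 ⟨hm, hM⟩
      omega

omit h0 h1 in
lemma insertionValue_lt_singleton_singleton {v w w' : Fin n} (hv : 2 ≤ v.1)
    (hvw : v.1 ≤ w.1) (hvw' : v.1 ≤ w'.1) (hne : w ≠ w') :
    insertionValue n v.1 < sqLinkage n K j b 0 {w} {w'} := by
  apply lt_sqLinkage_zero_of_forall (by simp) (by simp)
  intro x hx y hy
  rw [Finset.mem_singleton] at hx hy
  subst hx hy
  have hne' : x.1 ≠ y.1 := fun h => hne (Fin.ext h)
  by_cases hv4 : 4 ≤ v.1
  · have e : insertionValue n v.1 = level n v.1 := by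
      unfold insertionValue
      rw [if_neg (by omega), if_neg (by omega)]
    rw [e, sqDist_zero]
    by_cases hK' : max x.1 y.1 < K
    · refine lt_of_lt_of_le (level_lt_level (show 0 < n by omega) ?_)
        (level_le_baseSq hn hKn ?_ ?_ hK') <;> omega
    · rw [baseSq_far (not_lt.1 hK')]
      linarith [sixteen_le_far n, level_le hn (show v.1 ≤ n by omega)]
  · apply insertionValue_lt_of_lt_four j (by omega) <;> omega

/-! ### The perturbation -/

omit h0 h1 hn hKn in
lemma hasDerivAt_sqDist_rpow (x y : ℕ) :
    HasDerivAt (fun ε => sqDist n K j ε x y ^ (1 + ε * b))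
      (pertSq n K (min x y) (max x y) +
        b * (sqDist n K j 0 x y * Real.log (sqDist n K j 0 x y))) 0 := by
  have h1 : HasDerivAt (fun ε => sqDist n K j ε x y) (pertSq n K (min x y) (max x y)) 0 := by
    unfold sqDist
    simpa using ((hasDerivAt_id (0 : ℝ)).mul_const (pertSq n K (min x y) (max x y))).const_add
      (baseSq n K j (min x y) (max x y))
  have h2 : HasDerivAt (fun ε : ℝ => 1 + ε * b) b 0 := by
    simpa using ((hasDerivAt_id (0 : ℝ)).mul_const b).const_add 1
  have h3 : 0 < sqDist n K j 0 x y := by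
    rw [sqDist_zero]
    exact baseSq_pos _ _
  convert h1.rpow h2 h3 using 1
  simp
  ring

omit h0 h1 hn hKn in
lemma eventually_sqLinkage_lt {X Y X' Y' : Finset (Fin n)}
    (h : sqLinkage n K j b 0 X Y < sqLinkage n K j b 0 X' Y') :
    ∀ᶠ ε in 𝓝 (0 : ℝ), sqLinkage n K j b ε X Y < sqLinkage n K j b ε X' Y' := by
  have hc : ∀ X Y : Finset (Fin n), ContinuousAt (fun ε => sqLinkage n K j b ε X Y) 0 := by
    intro X Y
    unfold sqLinkage
    refine ContinuousAt.div_const ?_ _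
    refine tendsto_finsetSum _ fun x _ => tendsto_finsetSum _ fun y _ => ?_
    exact (hasDerivAt_sqDist_rpow j b x.1 y.1).continuousAt
  exact (hc X Y).eventually_lt (hc X' Y') h

omit h0 h1 hn hKn in
lemma eventually_pos_of_hasDerivAt {f : ℝ → ℝ} {c : ℝ} (hf : HasDerivAt f c 0) (h0 : f 0 = 0)
    (hc : 0 < c) : ∀ᶠ ε in 𝓝[>] (0 : ℝ), 0 < f ε := by
  have := hf.tendsto_slope_zero_right.eventually (lt_mem_nhds hc)
  filter_upwards [this, self_mem_nhdsWithin] with ε h1 h2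
  simp only [zero_add, h0, sub_zero, smul_eq_mul] at h1
  have h2' : 0 < ε := h2
  exact (mul_pos_iff_of_pos_left (inv_pos.2 h2')).1 h1

omit hn in
/-- The side of an even point is decided by the derivative in the perturbation: it is a positive
multiple of the digits of `bitCode` from the bit of that point on. -/
lemma eventually_wrong_side {v : Fin n} (hv : 4 ≤ v.1) (hvK : v.1 < K) (heven : v.1 % 2 = 0) :
    ∀ᶠ ε in 𝓝[>] (0 : ℝ),
      sqLinkage n K j (bitCode n T) ε {v} (cluster n (pairSide T) (pairSide T v.1) v.1) <
        sqLinkage n K j (bitCode n T) ε {v} (cluster n (pairSide T) (!pairSide T v.1) v.1) := by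
  obtain ⟨t, ht⟩ : ∃ t, v.1 = 2 * t := ⟨v.1 / 2, by omega⟩
  have htn : 2 * t ≤ n := by omega
  have ht2 : 2 ≤ t := by omega
  set b := bitCode n T with hb
  set g : ℝ → ℕ → ℝ := fun ε x => sqDist n K j ε (2 * t) x ^ (1 + ε * b) with hg
  set g' : ℕ → ℝ := fun x => pertSq n K (min (2 * t) x) (max (2 * t) x) +
    b * (sqDist n K j 0 (2 * t) x * Real.log (sqDist n K j 0 (2 * t) x)) with hg'
  have hgd : ∀ x, HasDerivAt (fun ε => g ε x) (g' x) 0 := fun x =>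
    hasDerivAt_sqDist_rpow j b (2 * t) x
  have hd : HasDerivAt (fun ε => ∑ u ∈ Finset.range t,
      bitSign T u * (g ε (2 * u + 1) - g ε (2 * u)))
      (∑ u ∈ Finset.range t, bitSign T u * (g' (2 * u + 1) - g' (2 * u))) 0 :=
    HasDerivAt.fun_sum fun u _ => ((hgd _).sub (hgd _)).const_mul _
  have hbase : ∀ x, x < 2 * t → sqDist n K j 0 (2 * t) x = baseSq n K j x (2 * t) := by
    intro x hx
    rw [sqDist_zero, min_eq_right hx.le, max_eq_left hx.le]
  have hK2 : ¬ K ≤ 2 * t := by omega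
  have h4 : ¬ 2 * t < 4 := by omega
  have hodd : ¬ 2 * t = 2 * j + 1 := by omega
  -- From the pairs of later points only the recorded bits contribute to the derivative, ...
  have hmark : ∀ u ∈ Finset.Ico 2 t,
      bitSign T u * (g' (2 * u + 1) - g' (2 * u)) =
        -anchorGap n (2 * t) * (bitSign T u * (1 / 2) ^ u) := by
    intro u hu
    rw [Finset.mem_Ico] at hu
    have e1 : baseSq n K j (2 * u + 1) (2 * t) = baseSq n K j (2 * u) (2 * t) := by
      have : u ≠ 0 := by omega
      have : u ≠ 1 := by omega
      have : 2 * u ≠ 1 := by omega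
      have : 2 * u ≠ 3 := by omega
      have : 2 * u + 1 ≠ 2 := by omega
      have : 2 * u ≠ 2 := by omega
      simp [baseSq, *]
    have e2 : pertSq n K (2 * u + 1) (2 * t) = 0 := by
      unfold pertSq
      rw [if_neg (by omega)]
    have e3 : pertSq n K (2 * u) (2 * t) = anchorGap n (2 * t) * (1 / 2) ^ u := by
      unfold pertSq
      rw [if_pos (by omega), show 2 * u / 2 = u by omega]
    simp only [hg']
    rw [hbase _ (by omega), hbase _ (by omega), e1, min_eq_right (by omega),
      max_eq_left (by omega), min_eq_right (by omega), max_eq_left (by omega), e2, e3]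
    ring
  -- ... and from the anchors only the exponent.
  have hanchor : bitSign T 0 * (g' (2 * 0 + 1) - g' (2 * 0)) +
      bitSign T 1 * (g' (2 * 1 + 1) - g' (2 * 1)) = b * anchorGap n (2 * t) := by
    simp only [hg', bitSign, h0, h1, if_false]
    rw [hbase _ (by omega), hbase _ (by omega), hbase _ (by omega), hbase _ (by omega)]
    simp [pertSq, baseSq, hK2, h4, hodd, anchorGap]
    ring
  have hderiv : ∑ u ∈ Finset.range t, bitSign T u * (g' (2 * u + 1) - g' (2 * u)) =
      anchorGap n (2 * t) * ∑ u ∈ Finset.Ico t n, bitSign T u * (1 / 2 : ℝ) ^ u := by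
    rw [← Finset.sum_range_add_sum_Ico _ ht2, Finset.sum_congr rfl hmark, ← Finset.mul_sum,
      Finset.sum_range_succ, Finset.sum_range_one, hanchor, hb, bitCode,
      ← Finset.sum_Ico_consecutive _ ht2 (show t ≤ n by omega)]
    ring
  have hpos : 0 < bitSign T t *
      ∑ u ∈ Finset.range t, bitSign T u * (g' (2 * u + 1) - g' (2 * u)) := by
    rw [hderiv, mul_left_comm]
    exact mul_pos (anchorGap_pos _ _) (bitSign_mul_sum_pos T (by omega))
  have hD := (hd.const_mul (bitSign T t))
  have hlink : ∀ ε s, sqLinkage n K j b ε {v} (cluster n (pairSide T) s v.1) =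
      (∑ x ∈ cluster n (pairSide T) s (2 * t), g ε x.1) / t := by
    intro ε s
    unfold sqLinkage
    rw [Finset.sum_singleton, Finset.card_singleton, Nat.cast_one, one_mul, ht,
      card_cluster_even T s t htn]
  have hzero : bitSign T t * ∑ u ∈ Finset.range t,
      bitSign T u * (g 0 (2 * u + 1) - g 0 (2 * u)) = 0 := by
    have hA : ∀ s, ∑ x ∈ cluster n (pairSide T) s (2 * t), g 0 x.1 =
        (cluster n (pairSide T) s (2 * t)).card * level n (2 * t) := by
      intro s
      have := sum_singleton_cluster h0 h1 j hKn (v := v) (w := v) hv le_rfl hvK s 0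
      rw [Finset.sum_singleton, if_neg (by omega), zero_add] at this
      simpa [hg, ht] using this
    rw [← sum_cluster_sub_sum_cluster T (g 0) t htn, hA, hA, card_cluster_even T _ t htn,
      card_cluster_even T _ t htn, sub_self, mul_zero]
  have ht0 : (0 : ℝ) < t := by exact_mod_cast (show 0 < t by omega)
  filter_upwards [eventually_pos_of_hasDerivAt hD hzero hpos] with ε hε
  rw [← sum_cluster_sub_sum_cluster T (g ε) t htn] at hε
  rw [hlink, hlink]
  apply div_lt_div_of_pos_right _ ht0
  rw [ht, pairSide_even]
  by_cases hT : t ∈ T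
  · simp only [bitSign, hT, if_true, one_mul] at hε
    simp only [hT, decide_true, Bool.not_true]
    linarith
  · simp only [bitSign, hT, if_false] at hε
    simp only [hT, decide_false, Bool.not_false]
    linarith

/-- For small perturbations every point is inserted on its side, without a tie. -/
lemma eventually_insertion_isBest {v : Fin n} (hv : 2 ≤ v.1) (hvK : v.1 < K) :
    ∀ᶠ ε in 𝓝[>] (0 : ℝ), ∀ X ∈ currentClusters n (pairSide T) v.1,
      ∀ Y ∈ currentClusters n (pairSide T) v.1, X ≠ Y →
      (X = {v} ∧ Y = cluster n (pairSide T) (pairSide T v.1) v.1) ∨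
      (X = cluster n (pairSide T) (pairSide T v.1) v.1 ∧ Y = {v}) ∨
      sqLinkage n K j (bitCode n T) ε {v} (cluster n (pairSide T) (pairSide T v.1) v.1) <
        sqLinkage n K j (bitCode n T) ε X Y := by
  set b := bitCode n T
  have hins := sqLinkage_zero_insertion h0 h1 j b hn hKn hv hvK
  have hcross : ∀ᶠ ε in 𝓝[>] (0 : ℝ),
      sqLinkage n K j b ε {v} (cluster n (pairSide T) (pairSide T v.1) v.1) <
        sqLinkage n K j b ε (cluster n (pairSide T) false v.1)
          (cluster n (pairSide T) true v.1) :=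
    nhdsWithin_le_nhds (eventually_sqLinkage_lt j b (by
      rw [hins]
      exact insertionValue_lt_cross h0 h1 j b hn hKn hv hvK))
  have hpoint : ∀ᶠ ε in 𝓝[>] (0 : ℝ), ∀ (w : Fin n) (s : Bool), v.1 ≤ w.1 →
      (w = v → s ≠ pairSide T v.1) →
      sqLinkage n K j b ε {v} (cluster n (pairSide T) (pairSide T v.1) v.1) <
        sqLinkage n K j b ε {w} (cluster n (pairSide T) s v.1) := by
    simp only [eventually_all]
    intro w s hw hs
    by_cases h : w = v ∧ 4 ≤ v.1 ∧ v.1 % 2 = 0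
    · obtain ⟨rfl, h4, heven⟩ := h
      have hs' : s = !pairSide T w.1 := by
        have := hs rfl
        cases s <;> cases hh : pairSide T w.1 <;> simp_all
      rw [hs']
      exact eventually_wrong_side h0 h1 j hKn h4 hvK heven
    · refine nhdsWithin_le_nhds (eventually_sqLinkage_lt j b ?_)
      rw [hins]
      exact insertionValue_lt_singleton_cluster h0 h1 j b hn hKn hv hw
        fun h' => ⟨hs h', fun h'' => h ⟨h', h''⟩⟩
  have hpoints : ∀ᶠ ε in 𝓝[>] (0 : ℝ), ∀ w w' : Fin n, v.1 ≤ w.1 → v.1 ≤ w'.1 → w ≠ w' →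
      sqLinkage n K j b ε {v} (cluster n (pairSide T) (pairSide T v.1) v.1) <
        sqLinkage n K j b ε {w} {w'} := by
    simp only [eventually_all]
    intro w w' hw hw' hne
    refine nhdsWithin_le_nhds (eventually_sqLinkage_lt j b ?_)
    rw [hins]
    exact insertionValue_lt_singleton_singleton j b hn hKn hv hw hw' hne
  filter_upwards [hcross, hpoint, hpoints] with ε e1 e2 e3 X hX Y hY hXY
  rw [mem_currentClusters] at hX hY
  rcases hX with ⟨s, rfl⟩ | ⟨x, hx, rfl⟩ <;> rcases hY with ⟨s', rfl⟩ | ⟨y, hy, rfl⟩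
  · right; right
    cases s <;> cases s'
    · exact absurd rfl hXY
    · exact e1
    · rw [sqLinkage_comm n K j b ε (cluster n (pairSide T) true v.1)]
      exact e1
    · exact absurd rfl hXY
  · by_cases h : y = v ∧ s = pairSide T v.1
    · obtain ⟨rfl, rfl⟩ := h
      exact Or.inr (Or.inl ⟨rfl, rfl⟩)
    · right; right
      rw [sqLinkage_comm n K j b ε _ {y}]
      exact e2 y s hy fun h1 h2 => h ⟨h1, h2⟩
  · by_cases h : x = v ∧ s' = pairSide T v.1
    · obtain ⟨rfl, rfl⟩ := h
      exact Or.inl ⟨rfl, rfl⟩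
    · exact Or.inr (Or.inr (e2 x s' hx fun h1 h2 => h ⟨h1, h2⟩))
  · exact Or.inr (Or.inr (e3 x y hx hy fun h => hXY (by rw [h])))

end Pattern

/-! ### The instances -/

/-- The perturbation `ε` is nonnegative and small enough to keep all squared distances of points
below `K` within a factor of four; then the triangle inequality for their distances is automatic. -/
def SmallPert (n K : ℕ) (ε : ℝ) : Prop :=
  0 ≤ ε ∧ ∀ x y : Fin n, ε * pertSq n K x.1 y.1 ≤ 2 / 5

section Instance

variable {n K : ℕ} (hn : 4 ≤ n) (hKn : K ≤ n) (j : ℕ) {ε : ℝ} (hε : SmallPert n K ε)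

lemma pertSq_nonneg (x y : ℕ) : 0 ≤ pertSq n K x y := by
  unfold pertSq
  have := (anchorGap_pos n y).le
  split_ifs <;> positivity

lemma sqDist_far {x y : ℕ} (h : K ≤ x ∨ K ≤ y) :
    sqDist n K j ε x y = (4 * (n : ℝ) + 4) ^ 2 := by
  have h' : K ≤ max x y := le_max_iff.2 h
  have : pertSq n K (min x y) (max x y) = 0 := by
    unfold pertSq
    rw [if_neg (by omega)]
  rw [sqDist, baseSq_far h', this, mul_zero, add_zero]

include hε in
lemma baseSq_le_sqDist (x y : ℕ) :
    baseSq n K j (min x y) (max x y) ≤ sqDist n K j ε x y := by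
  have := mul_nonneg hε.1 (pertSq_nonneg (n := n) (K := K) (min x y) (max x y))
  unfold sqDist
  linarith

include hε in
lemma le_sqDist (x y : ℕ) : 3 / 5 ≤ sqDist n K j ε x y :=
  (baseSq_lower _ _).1.trans (baseSq_le_sqDist j hε x y)

include hn hKn hε in
lemma sqDist_le {x y : ℕ} (hx : x < K) (hy : y < K) : sqDist n K j ε x y ≤ 12 / 5 := by
  have h1 := baseSq_le_two (j := j) (x := min x y) hn hKn (max_lt hx hy)
  have h2 := hε.2 ⟨min x y, by omega⟩ ⟨max x y, by omega⟩
  unfold sqDist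
  simp only at h2
  linarith

include hn hKn hε in
lemma sqrt_sqDist_triangle (x y z : ℕ) :
    √(sqDist n K j ε x z) ≤ √(sqDist n K j ε x y) + √(sqDist n K j ε y z) := by
  have hfar : ∀ x y : ℕ, K ≤ x ∨ K ≤ y → √(sqDist n K j ε x y) = 4 * (n : ℝ) + 4 := by
    intro x y h
    rw [sqDist_far j h, Real.sqrt_sq (by positivity)]
  by_cases hx : K ≤ x
  · rw [hfar x z (Or.inl hx), hfar x y (Or.inl hx)]
    linarith [Real.sqrt_nonneg (sqDist n K j ε y z)]
  by_cases hz : K ≤ z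
  · rw [hfar x z (Or.inr hz), hfar y z (Or.inr hz)]
    linarith [Real.sqrt_nonneg (sqDist n K j ε x y)]
  rw [not_le] at hx hz
  have h1 : √(sqDist n K j ε x z) ≤ 2 * √(3 / 5) := by
    rw [Real.sqrt_le_left (by positivity), mul_pow, Real.sq_sqrt (by norm_num)]
    linarith [sqDist_le hn hKn j hε hx hz]
  have h2 := Real.sqrt_le_sqrt (le_sqDist (n := n) (K := K) j hε x y)
  have h3 := Real.sqrt_le_sqrt (le_sqDist (n := n) (K := K) j hε y z)
  linarith

/-- The clustering instance with squared distances `sqDist`. -/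
noncomputable def pairInstance : ClusteringInstance n where
  d x y := if x = y then 0 else √(sqDist n K j ε x.1 y.1)
  d_nonneg x y := by
    split_ifs
    · exact le_rfl
    · exact Real.sqrt_nonneg _
  d_eq_zero_iff x y := by
    have h : 0 < √(sqDist n K j ε x.1 y.1) :=
      Real.sqrt_pos.2 (lt_of_lt_of_le (by norm_num) (le_sqDist j hε x.1 y.1))
    split_ifs with hxy
    · simp [hxy]
    · simp [hxy, h.ne']
  d_comm x y := by
    simp only [eq_comm (a := x), sqDist_comm n K j ε x.1]
  d_triangle x y z := by
    have hnn := fun a b : Fin n => Real.sqrt_nonneg (sqDist n K j ε a.1 b.1)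
    by_cases hxz : x = z
    · rw [if_pos hxz]
      split_ifs <;> positivity
    · rw [if_neg hxz]
      by_cases hxy : x = y
      · subst hxy
        simp [hxz]
      · by_cases hyz : y = z
        · subst hyz
          simp [hxy]
        · rw [if_neg hxy, if_neg hyz]
          exact sqrt_sqDist_triangle hn hKn j hε x.1 y.1 z.1

lemma pairInstance_d_of_ne {x y : Fin n} (h : x ≠ y) :
    (pairInstance hn hKn j hε).d x y = √(sqDist n K j ε x.1 y.1) := if_neg h

lemma avgPowLinkage_pairInstance (b : ℝ) {X Y : Finset (Fin n)} (hXY : Disjoint X Y) :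
    avgPowLinkage (pairInstance hn hKn j hε) (2 + 2 * (ε * b)) X Y =
      sqLinkage n K j b ε X Y := by
  unfold avgPowLinkage sqLinkage
  congr 1
  refine Finset.sum_congr rfl fun x hx => Finset.sum_congr rfl fun y hy => ?_
  have hne : x ≠ y := fun h => Finset.disjoint_left.1 hXY hx (h ▸ hy)
  rw [pairInstance_d_of_ne hn hKn j hε hne, Real.sqrt_eq_rpow, ← Real.rpow_mul]
  · congr 1
    ring
  · linarith [le_sqDist (n := n) (K := K) j hε x.1 y.1]

end Instance

lemma disjoint_of_mem_currentClusters {n : ℕ} {side : ℕ → Bool} {v : ℕ} {X Y : Finset (Fin n)}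
    (hX : X ∈ currentClusters n side v) (hY : Y ∈ currentClusters n side v) (h : X ≠ Y) :
    Disjoint X Y := by
  rw [mem_currentClusters] at hX hY
  rw [Finset.disjoint_left]
  rcases hX with ⟨s, rfl⟩ | ⟨x, hx, rfl⟩ <;> rcases hY with ⟨s', rfl⟩ | ⟨y, hy, rfl⟩ <;>
    intro a ha hb <;>
    simp only [mem_cluster, Finset.mem_singleton] at ha hb
  · exact h (by rw [← ha.2, ← hb.2])
  · subst hb; omega
  · subst ha; omega
  · exact h (by rw [← ha, ← hb])

/-- A perturbation that is small enough for all marked points and all bit patterns at once. -/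
lemma exists_perturbation {n K : ℕ} (hn : 4 ≤ n) (hKn : K ≤ n) :
    ∃ (ε : ℝ) (hε : SmallPert n K ε), ∀ T ⊆ Finset.Ico 2 n,
      2 + 2 * (ε * bitCode n T) ∈ Set.Ioo (1 : ℝ) 3 ∧
      ∀ j < n, ∀ v : Fin n, 2 ≤ v.1 → v.1 < K →
        InsertionIsBest (pairInstance hn hKn j hε) (2 + 2 * (ε * bitCode n T)) (pairSide T) v := by
  have hsmall : ∀ᶠ ε in 𝓝[>] (0 : ℝ), ∀ x y : Fin n, ε * pertSq n K x.1 y.1 ≤ 2 / 5 := by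
    simp only [eventually_all]
    intro x y
    have hc : ContinuousAt (fun ε : ℝ => ε * pertSq n K x.1 y.1) 0 := by fun_prop
    have : ∀ᶠ ε in 𝓝 (0 : ℝ), ε * pertSq n K x.1 y.1 < 2 / 5 :=
      hc.eventually_lt continuousAt_const (by norm_num)
    exact nhdsWithin_le_nhds (this.mono fun _ h => h.le)
  have hbest : ∀ᶠ ε in 𝓝[>] (0 : ℝ), ∀ T ∈ (Finset.Ico 2 n).powerset, ∀ j ∈ Finset.range n,
      ∀ v : Fin n, 2 ≤ v.1 → v.1 < K → ∀ X ∈ currentClusters n (pairSide T) v.1,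
      ∀ Y ∈ currentClusters n (pairSide T) v.1, X ≠ Y →
      (X = {v} ∧ Y = cluster n (pairSide T) (pairSide T v.1) v.1) ∨
      (X = cluster n (pairSide T) (pairSide T v.1) v.1 ∧ Y = {v}) ∨
      sqLinkage n K j (bitCode n T) ε {v} (cluster n (pairSide T) (pairSide T v.1) v.1) <
        sqLinkage n K j (bitCode n T) ε X Y := by
    rw [eventually_all_finset]
    intro T hT
    rw [eventually_all_finset]
    intro j _
    rw [eventually_all]
    intro v
    by_cases hv : 2 ≤ v.1 ∧ v.1 < K
    · have hT' := Finset.mem_powerset.1 hT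
      refine (eventually_insertion_isBest (T := T) (fun h => ?_) (fun h => ?_) j hn hKn hv.1
        hv.2).mono fun ε h _ _ => h
      · simpa using hT' h
      · simpa using hT' h
    · exact Eventually.of_forall fun ε h h' => absurd ⟨h, h'⟩ hv
  have hhalf : ∀ᶠ ε in 𝓝[>] (0 : ℝ), ε < 1 / 2 :=
    nhdsWithin_le_nhds (gt_mem_nhds (by norm_num))
  have hpos : ∀ᶠ ε in 𝓝[>] (0 : ℝ), 0 < ε := self_mem_nhdsWithin
  obtain ⟨ε, hε0', h1, h2, h3⟩ := (hpos.and (hsmall.and (hbest.and hhalf))).exists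
  have hε : SmallPert n K ε := ⟨hε0'.le, h1⟩
  refine ⟨ε, hε, fun T hT => ⟨?_, fun j hj v hv hvK => ?_⟩⟩
  · have hb := abs_le.1 (abs_bitCode_le n (by omega) T)
    constructor <;> nlinarith
  · intro X hX Y hY hXY
    rw [avgPowLinkage_pairInstance hn hKn j hε _ (disjoint_of_mem_currentClusters hX hY hXY),
      avgPowLinkage_pairInstance hn hKn j hε _ (by simp)]
    exact h2 T (Finset.mem_powerset.2 hT) j (Finset.mem_range.2 hj) v hv hvK X hX Y hY hXY

/-! ### Exponentially many merge trees -/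

/-- A laminar family contains a colour class of at most one of two bit patterns that differ on a
complete pair. -/
lemma eq_of_laminar_cluster {n : ℕ} {T T' : Finset ℕ} (hT : T ⊆ Finset.Ico 2 (n / 2))
    (hT' : T' ⊆ Finset.Ico 2 (n / 2)) (hn : 1 ≤ n)
    (h : cluster n (pairSide T) false n ⊆ cluster n (pairSide T') false n ∨
      cluster n (pairSide T') false n ⊆ cluster n (pairSide T) false n ∨
      Disjoint (cluster n (pairSide T) false n) (cluster n (pairSide T') false n)) : T = T' := by
  have key : ∀ {T T' : Finset ℕ}, T ⊆ Finset.Ico 2 (n / 2) → T' ⊆ Finset.Ico 2 (n / 2) →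
      cluster n (pairSide T) false n ⊆ cluster n (pairSide T') false n → T = T' := by
    intro T T' hT hT' h
    ext t
    by_cases ht : t < n / 2
    · have e1 := @h ⟨2 * t, by omega⟩
      have e2 := @h ⟨2 * t + 1, by omega⟩
      simp only [mem_cluster, pairSide_even, pairSide_odd] at e1 e2
      by_cases h1 : t ∈ T <;> by_cases h2 : t ∈ T' <;> simp [h1, h2] at e1 e2 ⊢ <;> omega
    · have h1 : t ∉ T := fun h => ht (Finset.mem_Ico.1 (hT h)).2
      have h2 : t ∉ T' := fun h => ht (Finset.mem_Ico.1 (hT' h)).2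
      simp [h1, h2]
  rcases h with h | h | h
  · exact key hT hT' h
  · exact (key hT' hT h).symm
  · exfalso
    have z : ∀ T : Finset ℕ, T ⊆ Finset.Ico 2 (n / 2) →
        (⟨0, by omega⟩ : Fin n) ∈ cluster n (pairSide T) false n := by
      intro T hT
      have : 0 ∉ T := fun h => by simpa using hT h
      simp [pairSide, this]
      omega
    exact Finset.disjoint_left.1 h (z T hT) (z T' hT')

theorem exists_many_mergeTrees (n : ℕ) (hn : 8 ≤ n) :
    ∃ (V : ClusteringInstance n) (S : Finset ℝ) (tree : ℝ → Finset (Finset (Fin n))),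
      S.card = 2 ^ ((n - 8) / 2) + 2 ∧
      (∀ α ∈ S, α ∈ Set.Ioo (1 : ℝ) 3) ∧
      (∀ α ∈ S, ∀ T : Finset (Finset (Fin n)), IsMergeTree V α T ↔ T = tree α) ∧
      Set.InjOn tree (S : Set ℝ) := by
  have hn4 : 4 ≤ n := by omega
  obtain ⟨ε, hε, h⟩ := exists_perturbation hn4 le_rfl
  set V := pairInstance hn4 le_rfl 0 hε
  set code : Finset ℕ → ℝ := fun T => 2 + 2 * (ε * bitCode n T) with hcode
  set patterns := (Finset.Ico 2 (n / 2)).powerset with hpat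
  have hsub : ∀ T ∈ patterns, T ⊆ Finset.Ico 2 (n / 2) := fun T hT => Finset.mem_powerset.1 hT
  have hsub' : ∀ T ∈ patterns, T ⊆ Finset.Ico 2 n := fun T hT =>
    (hsub T hT).trans (Finset.Ico_subset_Ico_right (by omega))
  have hside : ∀ T ∈ patterns, pairSide T 0 = false ∧ pairSide T 1 = true := by
    intro T hT
    have h0 : 0 ∉ T := fun h => by simpa using hsub T hT h
    simp [pairSide, h0]
  have htree : ∀ T ∈ patterns, ∀ 𝒯, IsMergeTree V (code T) 𝒯 ↔
      𝒯 = insert Finset.univ (formedClusters n (pairSide T) n) := fun T hT 𝒯 =>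
    isMergeTree_iff_of_insertionIsBest (hside T hT).1 (hside T hT).2 (by omega)
      (fun v hv => (h T (hsub' T hT)).2 0 (by omega) v hv v.2) 𝒯
  have hmem : ∀ T, cluster n (pairSide T) false n ∈
      insert Finset.univ (formedClusters n (pairSide T) n) := fun T =>
    Finset.mem_insert_of_mem (mem_formedClusters.2 (Or.inr ⟨_, n, by omega, le_rfl, rfl⟩))
  have hinj : ∀ T ∈ patterns, ∀ T' ∈ patterns,
      insert Finset.univ (formedClusters n (pairSide T) n) =
        insert Finset.univ (formedClusters n (pairSide T') n) → T = T' := by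
    intro T hT T' hT' he
    refine eq_of_laminar_cluster (hsub T hT) (hsub T' hT') (by omega) ?_
    exact IsMergeTree.laminar ((htree T hT _).2 rfl) (hmem T) (he ▸ hmem T')
  choose! tree htree' using fun α (hα : α ∈ patterns.image code) =>
    (show ∃ 𝒯₀, ∀ 𝒯, IsMergeTree V α 𝒯 ↔ 𝒯 = 𝒯₀ by
      obtain ⟨T, hT, rfl⟩ := Finset.mem_image.1 hα
      exact ⟨_, htree T hT⟩)
  have htree_eq : ∀ T ∈ patterns, tree (code T) =
      insert Finset.univ (formedClusters n (pairSide T) n) := fun T hT =>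
    ((htree T hT _).1 ((htree' _ (Finset.mem_image_of_mem _ hT) _).2 rfl))
  -- There are more patterns than needed; any subset of the right size will do.
  have hcard : (patterns.image code).card = 2 ^ (n / 2 - 2) := by
    rw [Finset.card_image_of_injOn, hpat, Finset.card_powerset, Nat.card_Ico]
    intro T hT T' hT' he
    apply hinj T hT T' hT'
    rw [← htree_eq T hT, ← htree_eq T' hT']
    exact congrArg tree he
  have hle : 2 ^ ((n - 8) / 2) + 2 ≤ (patterns.image code).card := by
    rw [hcard, show n / 2 - 2 = (n - 8) / 2 + 2 by omega, pow_add]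
    have : 1 ≤ 2 ^ ((n - 8) / 2) := Nat.one_le_two_pow
    omega
  obtain ⟨S, hS, hScard⟩ := Finset.exists_subset_card_eq hle
  refine ⟨V, S, tree, hScard, fun α hα => ?_, fun α hα => htree' α (hS hα), ?_⟩
  · obtain ⟨T, hT, rfl⟩ := Finset.mem_image.1 (hS hα)
    exact (h T (hsub' T hT)).1
  · intro α hα β hβ he
    obtain ⟨T, hT, rfl⟩ := Finset.mem_image.1 (hS hα)
    obtain ⟨T', hT', rfl⟩ := Finset.mem_image.1 (hS hβ)
    rw [htree_eq T hT, htree_eq T' hT'] at he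
    rw [hinj T hT T' hT' he]

/-! ### Costs of clusters -/

section Cost

variable {n : ℕ} {V : ClusteringInstance n} {p : ℝ≥0∞} {C : Finset (Fin n)} {c : Fin n}

lemma ClusteringInstance.d_self (V : ClusteringInstance n) (x : Fin n) : V.d x x = 0 :=
  (V.d_eq_zero_iff x x).2 rfl

lemma one_le_toReal_of_ne_top (hp : 1 ≤ p) (hp' : p ≠ ∞) : 1 ≤ p.toReal := by
  simpa using ENNReal.toReal_mono hp' hp

lemma clusterCost_top : clusterCost V ∞ C c = ⨆ q : {q : Fin n // q ∈ C}, V.d q.1 c := by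
  simp [clusterCost]

lemma clusterCost_of_ne_top (hp' : p ≠ ∞) :
    clusterCost V p C c = (∑ q ∈ C, V.d q c ^ p.toReal) ^ (1 / p.toReal) := by
  simp [clusterCost, hp']

lemma clusterCost_nonneg : 0 ≤ clusterCost V p C c := by
  by_cases hp' : p = ∞
  · subst hp'
    rw [clusterCost_top]
    exact Real.iSup_nonneg fun q => V.d_nonneg _ _
  · rw [clusterCost_of_ne_top hp']
    exact Real.rpow_nonneg (Finset.sum_nonneg fun q _ => Real.rpow_nonneg (V.d_nonneg _ _) _) _

lemma d_le_clusterCost (hp : 1 ≤ p) {q : Fin n} (hq : q ∈ C) : V.d q c ≤ clusterCost V p C c := by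
  by_cases hp' : p = ∞
  · subst hp'
    rw [clusterCost_top]
    exact le_ciSup (f := fun q : {q : Fin n // q ∈ C} => V.d q.1 c) (Set.finite_range _).bddAbove
      ⟨q, hq⟩
  · rw [clusterCost_of_ne_top hp']
    have hp1 := one_le_toReal_of_ne_top hp hp'
    have hnn : ∀ q ∈ C, 0 ≤ V.d q c ^ p.toReal := fun q _ => Real.rpow_nonneg (V.d_nonneg _ _) _
    calc V.d q c = (V.d q c ^ p.toReal) ^ (1 / p.toReal) := by
          rw [← Real.rpow_mul (V.d_nonneg _ _), mul_one_div_cancel (by linarith), Real.rpow_one]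
      _ ≤ _ := Real.rpow_le_rpow (hnn q hq) (Finset.single_le_sum hnn hq)
          (div_nonneg zero_le_one (by linarith))

/-- The cost of a cluster is monotone along injections that increase the distances to the
centers. -/
lemma clusterCost_le_of_injOn (hp : 1 ≤ p) {V' : ClusteringInstance n} {C' : Finset (Fin n)}
    {c' : Fin n} (hC : C.Nonempty) (σ : Fin n → Fin n) (hσ : ∀ q ∈ C, σ q ∈ C')
    (hinj : Set.InjOn σ C) (hd : ∀ q ∈ C, V.d q c ≤ V'.d (σ q) c') :
    clusterCost V p C c ≤ clusterCost V' p C' c' := by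
  by_cases hp' : p = ∞
  · subst hp'
    have : Nonempty {q : Fin n // q ∈ C} := hC.to_subtype
    rw [clusterCost_top]
    exact ciSup_le fun q => (hd q.1 q.2).trans (d_le_clusterCost le_top (hσ q.1 q.2))
  · rw [clusterCost_of_ne_top hp', clusterCost_of_ne_top hp']
    have hp1 := one_le_toReal_of_ne_top hp hp'
    refine Real.rpow_le_rpow (Finset.sum_nonneg fun q _ => Real.rpow_nonneg (V.d_nonneg _ _) _) ?_
      (div_nonneg zero_le_one (by linarith))
    calc ∑ q ∈ C, V.d q c ^ p.toReal ≤ ∑ q ∈ C, V'.d (σ q) c' ^ p.toReal :=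
          Finset.sum_le_sum fun q hq =>
            Real.rpow_le_rpow (V.d_nonneg _ _) (hd q hq) (by linarith)
      _ = ∑ q ∈ C.image σ, V'.d q c' ^ p.toReal := by rw [Finset.sum_image hinj]
      _ ≤ _ := Finset.sum_le_sum_of_subset_of_nonneg (Finset.image_subset_iff.2 hσ)
          fun q _ _ => Real.rpow_nonneg (V'.d_nonneg _ _) _

/-- A strict version of `clusterCost_le_of_injOn`; for `p = ∞` one of the new distances has to
exceed all the old ones. -/
lemma clusterCost_lt_of_injOn (hp : 1 ≤ p) {V' : ClusteringInstance n} {C' : Finset (Fin n)}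
    {c' : Fin n} (σ : Fin n → Fin n) (hσ : ∀ q ∈ C, σ q ∈ C')
    (hinj : Set.InjOn σ C) (hd : ∀ q ∈ C, V.d q c ≤ V'.d (σ q) c') {q₀ : Fin n} (hq₀ : q₀ ∈ C)
    (hlt : ∀ q ∈ C, V.d q c < V'.d (σ q₀) c') :
    clusterCost V p C c < clusterCost V' p C' c' := by
  by_cases hp' : p = ∞
  · subst hp'
    have : Nonempty {q : Fin n // q ∈ C} := ⟨⟨q₀, hq₀⟩⟩
    obtain ⟨q, hq⟩ := exists_eq_ciSup_of_finite (f := fun q : {q : Fin n // q ∈ C} => V.d q.1 c)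
    rw [clusterCost_top, ← hq]
    exact (hlt q.1 q.2).trans_le (d_le_clusterCost le_top (hσ q₀ hq₀))
  · rw [clusterCost_of_ne_top hp', clusterCost_of_ne_top hp']
    have hp1 := one_le_toReal_of_ne_top hp hp'
    refine Real.rpow_lt_rpow (Finset.sum_nonneg fun q _ => Real.rpow_nonneg (V.d_nonneg _ _) _) ?_
      (div_pos one_pos (by linarith))
    calc ∑ q ∈ C, V.d q c ^ p.toReal < ∑ q ∈ C, V'.d (σ q) c' ^ p.toReal :=
          Finset.sum_lt_sum (fun q hq =>
            Real.rpow_le_rpow (V.d_nonneg _ _) (hd q hq) (by linarith))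
            ⟨q₀, hq₀, Real.rpow_lt_rpow (V.d_nonneg _ _) (hlt q₀ hq₀) (by linarith)⟩
      _ = ∑ q ∈ C.image σ, V'.d q c' ^ p.toReal := by rw [Finset.sum_image hinj]
      _ ≤ _ := Finset.sum_le_sum_of_subset_of_nonneg (Finset.image_subset_iff.2 hσ)
          fun q _ _ => Real.rpow_nonneg (V'.d_nonneg _ _) _

/-- A center is optimal if every other point of the cluster is at least as far from its fellows. -/
lemma clusterCost_le_of_center (hp : 1 ≤ p) {c' : Fin n} (hc : c ∈ C) (hc' : c' ∈ C)
    (h : ∀ x ∈ C, x ≠ c → x ≠ c' → c' ≠ c → V.d x c ≤ V.d x c') :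
    clusterCost V p C c ≤ clusterCost V p C c' := by
  rcases eq_or_ne c' c with rfl | hne
  · exact le_rfl
  refine clusterCost_le_of_injOn hp ⟨c, hc⟩ (Equiv.swap c c') (fun q hq => ?_)
    (Equiv.injective _).injOn fun q hq => ?_
  · by_cases h1 : q = c
    · rw [h1, Equiv.swap_apply_left]
      exact hc'
    · by_cases h2 : q = c'
      · rw [h2, Equiv.swap_apply_right]
        exact hc
      · rw [Equiv.swap_apply_of_ne_of_ne h1 h2]
        exact hq
  · by_cases h1 : q = c
    · rw [h1, Equiv.swap_apply_left, V.d_self]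
      exact V.d_nonneg _ _
    · by_cases h2 : q = c'
      · rw [h2, Equiv.swap_apply_right, V.d_comm]
      · rw [Equiv.swap_apply_of_ne_of_ne h1 h2]
        exact h q hq h1 h2 hne

lemma clusterCost_singleton (hp : 1 ≤ p) (x : Fin n) : clusterCost V p {x} x = 0 := by
  by_cases hp' : p = ∞
  · subst hp'
    refine le_antisymm ?_ clusterCost_nonneg
    have : Nonempty {q : Fin n // q ∈ ({x} : Finset (Fin n))} := ⟨⟨x, by simp⟩⟩
    rw [clusterCost_top]
    refine ciSup_le fun q => ?_
    rw [Finset.mem_singleton.1 q.2, V.d_self]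
  · have hp1 := one_le_toReal_of_ne_top hp hp'
    rw [clusterCost_of_ne_top hp', Finset.sum_singleton, V.d_self,
      Real.zero_rpow (by linarith), Real.zero_rpow (by positivity)]

lemma clusterCost_le_mul (hp : 1 ≤ p) (hC : C.Nonempty) {m : ℝ} (hm : 0 ≤ m)
    (h : ∀ q ∈ C, V.d q c ≤ m) : clusterCost V p C c ≤ n * m := by
  obtain ⟨q₀, hq₀⟩ := hC
  have hn1 : (1 : ℝ) ≤ n := by exact_mod_cast (show 1 ≤ n by have := q₀.2; omega)
  by_cases hp' : p = ∞
  · subst hp'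
    have : Nonempty {q : Fin n // q ∈ C} := ⟨⟨q₀, hq₀⟩⟩
    rw [clusterCost_top]
    refine ciSup_le fun q => (h q.1 q.2).trans ?_
    nlinarith
  · have hp1 := one_le_toReal_of_ne_top hp hp'
    rw [clusterCost_of_ne_top hp']
    have hpos : (0 : ℝ) < p.toReal := by linarith
    have hsum : ∑ q ∈ C, V.d q c ^ p.toReal ≤ n * m ^ p.toReal := by
      calc ∑ q ∈ C, V.d q c ^ p.toReal ≤ ∑ q ∈ C, m ^ p.toReal :=
            Finset.sum_le_sum fun q hq => Real.rpow_le_rpow (V.d_nonneg _ _) (h q hq) hpos.le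
        _ = C.card * m ^ p.toReal := by rw [Finset.sum_const, nsmul_eq_mul]
        _ ≤ n * m ^ p.toReal := by
            have : (C.card : ℝ) ≤ n := by exact_mod_cast (Finset.card_le_univ _).trans (by simp)
            have := Real.rpow_nonneg hm p.toReal
            gcongr
    refine (Real.rpow_le_rpow (Finset.sum_nonneg fun q _ => Real.rpow_nonneg (V.d_nonneg _ _) _)
      hsum (by positivity)).trans ?_
    rw [Real.mul_rpow (by positivity) (Real.rpow_nonneg hm _), ← Real.rpow_mul hm,
      mul_one_div_cancel hpos.ne', Real.rpow_one]
    gcongr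
    calc (n : ℝ) ^ (1 / p.toReal) ≤ (n : ℝ) ^ (1 : ℝ) :=
          Real.rpow_le_rpow_of_exponent_le hn1 ((div_le_one hpos).2 hp1)
      _ = n := Real.rpow_one _

end Cost

/-! ### Partitions into two colour classes and far points -/

/-- A refinement with at most as many parts is not a proper refinement. -/
lemma Finpartition.eq_of_forall_subset {α : Type*} [DecidableEq α] {s : Finset α}
    {P Q : Finpartition s} (h : ∀ C ∈ P.parts, ∃ X ∈ Q.parts, C ⊆ X)
    (hcard : P.parts.card ≤ Q.parts.card) : P = Q := by
  choose! g hg hsub using h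
  have hsurj : Set.SurjOn g P.parts Q.parts := by
    intro X hX
    obtain ⟨x, hx⟩ := Q.nonempty_of_mem_parts hX
    obtain ⟨C, hC, hxC⟩ := P.exists_mem (Q.subset hX hx)
    exact ⟨C, hC, Q.eq_of_mem_parts (hg C hC) hX (hsub C hC hxC) hx⟩
  have hinj : Set.InjOn g P.parts := Finset.injOn_of_surjOn_of_card_le g hg hsurj hcard
  have hfix : ∀ C ∈ P.parts, g C = C := by
    intro C hC
    refine Finset.Subset.antisymm (fun x hx => ?_) (hsub C hC)
    obtain ⟨D, hD, hxD⟩ := P.exists_mem (Q.subset (hg C hC) hx)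
    have : g D = g C := Q.eq_of_mem_parts (hg D hD) (hg C hC) (hsub D hD hxD) hx
    rwa [← hinj hD hC this]
  refine Finpartition.ext (Finset.Subset.antisymm (fun C hC => ?_) fun X hX => ?_)
  · rw [← hfix C hC]
    exact hg C hC
  · obtain ⟨C, hC, rfl⟩ := hsurj hX
    rw [hfix C hC]
    exact hC

section TwoColor

variable {n : ℕ} {side : ℕ → Bool} {K : ℕ}

/-- Labels for the parts of the partition into two colour classes and singletons. -/
def labelCluster (n : ℕ) (side : ℕ → Bool) (K : ℕ) :
    Bool ⊕ {x : Fin n // K ≤ x.1} → Finset (Fin n)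
  | Sum.inl s => cluster n side s K
  | Sum.inr x => {x.1}

lemma mem_currentClusters_iff_label {X : Finset (Fin n)} :
    X ∈ currentClusters n side K ↔ ∃ i, labelCluster n side K i = X := by
  rw [mem_currentClusters]
  constructor
  · rintro (⟨s, rfl⟩ | ⟨x, hx, rfl⟩)
    · exact ⟨Sum.inl s, rfl⟩
    · exact ⟨Sum.inr ⟨x, hx⟩, rfl⟩
  · rintro ⟨s | x, rfl⟩
    · exact Or.inl ⟨s, rfl⟩
    · exact Or.inr ⟨x.1, x.2, rfl⟩

variable (h0 : side 0 = false) (h1 : side 1 = true) (hK : 2 ≤ K) (hKn : K ≤ n)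
include h0 h1 hK hKn

lemma labelCluster_injective : Function.Injective (labelCluster n side K) := by
  have hne : ∀ s, (cluster n side s K).Nonempty :=
    cluster_nonempty (hK.trans hKn) h0 h1 hK
  rintro (s | x) (s' | y) h <;> simp only [labelCluster] at h
  · obtain ⟨x, hx⟩ := hne s
    have hx' := hx
    rw [h, mem_cluster] at hx'
    rw [mem_cluster] at hx
    rw [← hx.2, hx'.2]
  · have : y.1 ∈ cluster n side s K := by rw [h]; simp
    rw [mem_cluster] at this
    exact absurd y.2 (by omega)
  · have : x.1 ∈ cluster n side s' K := by rw [← h]; simp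
    rw [mem_cluster] at this
    exact absurd x.2 (by omega)
  · rw [Finset.singleton_inj] at h
    rw [Subtype.ext h]

/-- The two colour classes of the points below `K`, and the singletons of the other points, as a
partition. -/
def twoColorPartition : Finpartition (Finset.univ : Finset (Fin n)) :=
  Finpartition.ofExistsUnique (currentClusters n side K) (fun _ _ => Finset.subset_univ _)
    (fun x _ => by
      have hex : ∃ X ∈ currentClusters n side K, x ∈ X := by
        by_cases hx : x.1 < K
        · exact ⟨_, mem_currentClusters.2 (Or.inl ⟨side x.1, rfl⟩), by simp [hx]⟩
        · exact ⟨{x}, mem_currentClusters.2 (Or.inr ⟨x, not_lt.1 hx, rfl⟩), by simp⟩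
      obtain ⟨X, hX, hxX⟩ := hex
      refine ⟨X, ⟨hX, hxX⟩, fun Y hY => ?_⟩
      by_contra hne
      exact Finset.disjoint_left.1 (disjoint_of_mem_currentClusters hX hY.1 (Ne.symm hne)) hxX
        hY.2)
    (fun h => by
      rw [mem_currentClusters] at h
      rcases h with ⟨s, h⟩ | ⟨x, _, h⟩
      · exact (cluster_nonempty (hK.trans hKn) h0 h1 hK s).ne_empty h.symm
      · exact Finset.singleton_ne_empty x h.symm)

@[simp] lemma twoColorPartition_parts :
    (twoColorPartition h0 h1 hK hKn).parts = currentClusters n side K := rfl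

/-- The labelling of the parts as a bijection. -/
noncomputable def partLabel : Bool ⊕ {x : Fin n // K ≤ x.1} ≃
    {C // C ∈ (twoColorPartition h0 h1 hK hKn).parts} :=
  Equiv.ofBijective (fun i => ⟨labelCluster n side K i, mem_currentClusters_iff_label.2 ⟨i, rfl⟩⟩)
    ⟨fun i i' h => labelCluster_injective h0 h1 hK hKn (Subtype.ext_iff.1 h), fun C => by
      obtain ⟨i, hi⟩ := mem_currentClusters_iff_label.1 C.2
      exact ⟨i, Subtype.ext hi⟩⟩

lemma card_twoColorPartition : (twoColorPartition h0 h1 hK hKn).parts.card = n - K + 2 := by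
  rw [← Fintype.card_coe, ← Fintype.card_congr (partLabel h0 h1 hK hKn), Fintype.card_sum,
    Fintype.card_bool, Fintype.card_subtype, add_comm]
  congr 1
  have : (Finset.univ.filter fun x : Fin n => K ≤ x.1) =
      (Finset.univ : Finset (Fin n)) \ Finset.univ.filter fun x : Fin n => x.1 < K := by
    ext x
    simp
  rw [this, Finset.card_sdiff_of_subset (Finset.subset_univ _), Finset.card_univ, Fintype.card_fin]
  congr 1
  have h2 : (Finset.univ.filter fun x : Fin n => x.1 < K) =
      Finset.univ.image (Fin.castLE hKn) := by
    ext x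
    simp only [Finset.mem_filter, Finset.mem_univ, true_and, Finset.mem_image]
    constructor
    · intro h
      exact ⟨⟨x.1, h⟩, rfl⟩
    · rintro ⟨y, rfl⟩
      exact y.2
  rw [h2, Finset.card_image_of_injective _ (Fin.castLE_injective hKn), Finset.card_univ,
    Fintype.card_fin]

lemma sum_twoColorPartition (f : Finset (Fin n) → ℝ) :
    ∑ C ∈ (twoColorPartition h0 h1 hK hKn).parts, f C =
      f (cluster n side false K) + f (cluster n side true K) +
        ∑ x : {x : Fin n // K ≤ x.1}, f {x.1} := by
  rw [← Finset.sum_coe_sort, ← (partLabel h0 h1 hK hKn).sum_comp (fun C => f C.1),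
    Fintype.sum_sum_type, Fintype.sum_bool]
  simp only [partLabel, Equiv.ofBijective_apply, labelCluster]
  ring

/-- Far singletons cost nothing. -/
lemma clusteringObjective_twoColorPartition {V : ClusteringInstance n} {p : ℝ≥0∞} (hp : 1 ≤ p)
    {c : Finset (Fin n) → Fin n} (hc : ∀ C ∈ (twoColorPartition h0 h1 hK hKn).parts, c C ∈ C) :
    clusteringObjective V p (twoColorPartition h0 h1 hK hKn) c =
      clusterCost V p (cluster n side false K) (c (cluster n side false K)) +
        clusterCost V p (cluster n side true K) (c (cluster n side true K)) := by
  unfold clusteringObjective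
  rw [sum_twoColorPartition h0 h1 hK hKn (fun C => clusterCost V p C (c C))]
  rw [Finset.sum_eq_zero, add_zero]
  intro x _
  have := hc {x.1} (mem_currentClusters.2 (Or.inr ⟨x.1, x.2, rfl⟩))
  rw [Finset.mem_singleton.1 this, clusterCost_singleton hp]

/-! ### The optimal pruning -/

/-- If the far points are at a distance that exceeds the cost of the two clusters, then the optimal
pruning with the right number of clusters isolates the far points, and laminarity leaves it no
choice for the other points. -/
lemma eq_twoColorPartition_of_optimal {V : ClusteringInstance n} {p : ℝ≥0∞} (hp : 1 ≤ p) {α : ℝ}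
    {T : Finset (Finset (Fin n))} (hT : IsMergeTree V α T) (hmem : ∀ s, cluster n side s K ∈ T)
    (hfar : ∀ x y : Fin n, x ≠ y → K ≤ x.1 → V.d x y = 4 * n + 4)
    (hnear : ∀ x y : Fin n, x.1 < K → y.1 < K → V.d x y ≤ 2)
    {P : Finpartition (Finset.univ : Finset (Fin n))} {c : Finset (Fin n) → Fin n}
    (hPc : IsCenteredPruning T (n - K + 2) P c)
    (hopt : ∀ (P' : Finpartition (Finset.univ : Finset (Fin n))) (c' : Finset (Fin n) → Fin n),
      IsCenteredPruning T (n - K + 2) P' c' →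
        clusteringObjective V p P c ≤ clusteringObjective V p P' c') :
    P = twoColorPartition h0 h1 hK hKn ∧
      ∀ c' : Finset (Fin n) → Fin n,
        (∀ C ∈ (twoColorPartition h0 h1 hK hKn).parts, c' C ∈ C) →
        clusteringObjective V p P c ≤
          clusteringObjective V p (twoColorPartition h0 h1 hK hKn) c' := by
  set P₀ := twoColorPartition h0 h1 hK hKn with hP₀
  have hn2 : 2 ≤ n := hK.trans hKn
  have hne : ∀ s, (cluster n side s K).Nonempty := cluster_nonempty hn2 h0 h1 hK
  have hpr : ∀ c' : Finset (Fin n) → Fin n, (∀ C ∈ P₀.parts, c' C ∈ C) →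
      IsCenteredPruning T (n - K + 2) P₀ c' := by
    intro c' hc'
    refine ⟨fun C hC => ?_, card_twoColorPartition h0 h1 hK hKn, hc'⟩
    rw [hP₀, twoColorPartition_parts, mem_currentClusters] at hC
    rcases hC with ⟨s, rfl⟩ | ⟨x, _, rfl⟩
    · exact hmem s
    · exact LinkageRun.singletonClusters_subset hT (Finset.mem_image_of_mem _ (Finset.mem_univ x))
  refine ⟨?_, fun c' hc' => hopt _ _ (hpr c' hc')⟩
  have hsmall : clusteringObjective V p P c < 4 * n + 4 := by
    have hex : ∀ C : Finset (Fin n), ∃ x : Fin n, C ∈ P₀.parts → x ∈ C := by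
      intro C
      by_cases hC : C ∈ P₀.parts
      · obtain ⟨x, hx⟩ := P₀.nonempty_of_mem_parts hC
        exact ⟨x, fun _ => hx⟩
      · exact ⟨⟨0, by omega⟩, fun h => absurd h hC⟩
    choose c' hc' using hex
    refine (hopt _ _ (hpr c' hc')).trans_lt ?_
    rw [hP₀, clusteringObjective_twoColorPartition h0 h1 hK hKn hp hc']
    have hcost : ∀ s, clusterCost V p (cluster n side s K) (c' (cluster n side s K)) ≤ n * 2 := by
      intro s
      refine clusterCost_le_mul hp (hne s) (by norm_num) fun q hq => hnear _ _ ?_ ?_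
      · exact (mem_cluster.1 hq).1
      · exact (mem_cluster.1 (hc' _ (mem_currentClusters.2 (Or.inl ⟨s, rfl⟩)))).1
    linarith [hcost false, hcost true]
  have hcost : ∀ C ∈ P.parts, clusterCost V p C (c C) < 4 * n + 4 := fun C hC =>
    (Finset.single_le_sum (f := fun C => clusterCost V p C (c C))
      (fun C _ => clusterCost_nonneg) hC).trans_lt hsmall
  have hiso : ∀ C ∈ P.parts, ∀ x ∈ C, K ≤ x.1 → C = {x} := by
    intro C hC x hx hxK
    by_contra hCx
    obtain ⟨y, hy, hyx⟩ : ∃ y ∈ C, y ≠ x := by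
      by_contra! hall
      exact hCx (Finset.eq_singleton_iff_unique_mem.2 ⟨hx, hall⟩)
    apply absurd (hcost C hC)
    rw [not_lt]
    by_cases hcx : c C = x
    · rw [hcx, ← hfar x y hyx.symm hxK, V.d_comm x y]
      exact d_le_clusterCost hp hy
    · rw [← hfar x (c C) (Ne.symm hcx) hxK]
      exact d_le_clusterCost hp hx
  have hcore : ∀ C ∈ P.parts, ∀ x ∈ C, x.1 < K → ∀ y ∈ C, y.1 < K := by
    intro C hC x hx hxK y hy
    by_contra hyK
    have hCy := hiso C hC y hy (not_lt.1 hyK)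
    rw [hCy, Finset.mem_singleton] at hx
    subst hx
    omega
  -- A part that meets both clusters contains them by laminarity; then there are too few parts left.
  have hside : ∀ C ∈ P.parts, (∃ x ∈ C, x.1 < K) → ∃ s, C ⊆ cluster n side s K := by
    rintro C hC ⟨x, hx, hxK⟩
    have hCK := hcore C hC x hx hxK
    by_contra! hnot
    have hsup : ∀ s, cluster n side s K ⊆ C := by
      intro s
      rcases IsMergeTree.laminar hT (hmem s) (hPc.1 hC) with h | h | h
      · exact h
      · exact absurd h (hnot s)
      · refine absurd (fun y hy => ?_) (hnot !s)
        rw [mem_cluster]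
        refine ⟨hCK y hy, ?_⟩
        have : side y.1 ≠ s := fun hs =>
          Finset.disjoint_left.1 h (mem_cluster.2 ⟨hCK y hy, hs⟩) hy
        cases s <;> cases hh : side y.1 <;> simp_all
    have hparts : P.parts ⊆ insert C ((Finset.univ.filter fun x : Fin n => K ≤ x.1).image
        fun x => {x}) := by
      intro D hD
      obtain ⟨y, hy⟩ := P.nonempty_of_mem_parts hD
      rw [Finset.mem_insert]
      by_cases hyK : y.1 < K
      · left
        exact P.eq_of_mem_parts hD hC hy (hsup (side y.1) (mem_cluster.2 ⟨hyK, rfl⟩))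
      · right
        rw [Finset.mem_image]
        exact ⟨y, by simpa using hyK, (hiso D hD y hy (not_lt.1 hyK)).symm⟩
    have hcardfar : (Finset.univ.filter fun x : Fin n => K ≤ x.1).card ≤ n - K := by
      have := card_twoColorPartition (n := n) h0 h1 hK hKn
      rw [← Fintype.card_coe, ← Fintype.card_congr (partLabel h0 h1 hK hKn), Fintype.card_sum,
        Fintype.card_bool, Fintype.card_subtype] at this
      omega
    have h1 := Finset.card_le_card hparts
    have h2 := Finset.card_insert_le C ((Finset.univ.filter fun x : Fin n => K ≤ x.1).image
        fun x => ({x} : Finset (Fin n)))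
    have h3 := Finset.card_image_le (s := Finset.univ.filter fun x : Fin n => K ≤ x.1)
      (f := fun x => ({x} : Finset (Fin n)))
    have h4 := hPc.2.1
    omega
  refine Finpartition.eq_of_forall_subset (fun C hC => ?_)
    (hPc.2.1.trans (card_twoColorPartition h0 h1 hK hKn).symm).le
  rw [hP₀, twoColorPartition_parts]
  obtain ⟨x, hx⟩ := P.nonempty_of_mem_parts hC
  by_cases hxK : x.1 < K
  · obtain ⟨s, hs⟩ := hside C hC ⟨x, hx, hxK⟩
    exact ⟨_, mem_currentClusters.2 (Or.inl ⟨s, rfl⟩), hs⟩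
  · exact ⟨_, mem_currentClusters.2 (Or.inr ⟨x, not_lt.1 hxK, rfl⟩),
      (hiso C hC x hx (not_lt.1 hxK)).subset⟩

end TwoColor

/-! ### Shattering -/

/-- Points on which the class realizes every pattern with one common threshold are distinct and
form a shattered set. -/
lemma exists_isShattered {X : Type*} {H : Set (X → ℝ)} (J : Finset ℕ) (f : ℕ → X) (r : ℝ)
    (h : ∀ T ⊆ J, ∃ g ∈ H, ∀ j ∈ J, g (f j) ≤ r ↔ j ∈ T) :
    ∃ S : Finset X, S.card = J.card ∧ IsShattered H S := by
  classical
  have hinj : Set.InjOn f J := by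
    intro i hi j hj hij
    obtain ⟨g, -, hg⟩ := h {i} (Finset.singleton_subset_iff.2 hi)
    have h1 := (hg i hi).2 (Finset.mem_singleton_self i)
    rw [hij] at h1
    exact (Finset.mem_singleton.1 ((hg j hj).1 h1)).symm
  refine ⟨J.image f, Finset.card_image_of_injOn hinj, fun _ => r, fun T _ => ?_⟩
  obtain ⟨g, hgH, hg⟩ := h (J.filter fun j => f j ∈ T) (Finset.filter_subset _ _)
  refine ⟨g, hgH, fun x hx => ?_⟩
  obtain ⟨j, hj, rfl⟩ := Finset.mem_image.1 hx
  rw [hg j hj, Finset.mem_filter]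
  exact and_iff_right hj

lemma IsShattered.mono {X : Type*} {H H' : Set (X → ℝ)} (hH : H ⊆ H') {S : Finset X}
    (h : IsShattered H S) : IsShattered H' S := by
  obtain ⟨r, hr⟩ := h
  refine ⟨r, fun T hT => ?_⟩
  obtain ⟨g, hg, hg'⟩ := hr T hT
  exact ⟨g, hH hg, hg'⟩

lemma IsShattered.card_le_pseudoDimension {X : Type*} {H : Set (X → ℝ)} {S : Finset X}
    (h : IsShattered H S) : (S.card : ℕ∞) ≤ pseudoDimension H :=
  le_iSup (fun S : {S : Finset X // IsShattered H S} => (S.1.card : ℕ∞)) ⟨S, h⟩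

/-! ### The output of the algorithm -/

section Output

variable {n K : ℕ} (hn : 4 ≤ n) (hKn : K ≤ n) (j : ℕ) {ε : ℝ} (hε : SmallPert n K ε)

lemma pairInstance_d_far {x y : Fin n} (hxy : x ≠ y) (h : K ≤ x.1) :
    (pairInstance hn hKn j hε).d x y = 4 * n + 4 := by
  rw [pairInstance_d_of_ne hn hKn j hε hxy, sqDist_far j (Or.inl h),
    Real.sqrt_sq (by positivity)]

lemma pairInstance_d_le_two {x y : Fin n} (hx : x.1 < K) (hy : y.1 < K) :
    (pairInstance hn hKn j hε).d x y ≤ 2 := by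
  rcases eq_or_ne x y with rfl | hxy
  · rw [ClusteringInstance.d_self]
    norm_num
  · rw [pairInstance_d_of_ne hn hKn j hε hxy, Real.sqrt_le_left (by norm_num)]
    linarith [sqDist_le hn hKn j hε hx hy]

lemma pairInstance_d_zero {x : Fin n} (h : (0 : ℕ) < n) (hx : 4 ≤ x.1) (hxK : x.1 < K) :
    (pairInstance hn hKn j hε).d x ⟨0, h⟩ = √(4 / 5) := by
  have hne : x ≠ ⟨0, h⟩ := fun h => by rw [h] at hx; simp at hx
  rw [pairInstance_d_of_ne hn hKn j hε hne]
  have h1 : ¬ K ≤ x.1 := by omega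
  have h2 : ¬ x.1 < 4 := by omega
  simp [sqDist, baseSq, pertSq, h1, h2]

lemma pairInstance_d_one {x : Fin n} (h : (1 : ℕ) < n) (hx : 4 ≤ x.1) (hxK : x.1 < K) :
    (pairInstance hn hKn j hε).d x ⟨1, h⟩ =
      √(if x.1 = 2 * j + 1 then 19 / 20 else 9 / 10) := by
  have hne : x ≠ ⟨1, h⟩ := fun h => by rw [h] at hx; simp at hx
  rw [pairInstance_d_of_ne hn hKn j hε hne]
  have h1 : ¬ K ≤ x.1 := by omega
  have h2 : ¬ x.1 < 4 := by omega
  rw [sqDist_comm, sqDist_of_lt _ _ _ _ (show 1 < x.1 by omega)]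
  simp [baseSq, pertSq, h1, h2]

lemma pairInstance_d_two_zero (h0 : (0 : ℕ) < n) (h2 : 2 < n) (hK : 4 ≤ K) :
    (pairInstance hn hKn j hε).d ⟨2, h2⟩ ⟨0, h0⟩ = √(3 / 5) := by
  have h1 : ¬ K ≤ 2 := by omega
  rw [pairInstance_d_of_ne hn hKn j hε (by simp)]
  simp [sqDist, baseSq, pertSq, h1]

lemma pairInstance_d_three_one (h1 : (1 : ℕ) < n) (h3 : 3 < n) (hK : 4 ≤ K) :
    (pairInstance hn hKn j hε).d ⟨3, h3⟩ ⟨1, h1⟩ = √(7 / 10) := by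
  have h2 : ¬ K ≤ 3 := by omega
  rw [pairInstance_d_of_ne hn hKn j hε (by simp)]
  simp [sqDist, baseSq, pertSq, h2]

lemma sqrt_baseSq_le_d {x y : Fin n} (hxy : x ≠ y) :
    √(baseSq n K j (min x.1 y.1) (max x.1 y.1)) ≤ (pairInstance hn hKn j hε).d x y := by
  rw [pairInstance_d_of_ne hn hKn j hε hxy]
  exact Real.sqrt_le_sqrt (baseSq_le_sqDist j hε _ _)

lemma one_le_baseSq {x y : ℕ} (hx : 3 ≤ x) (hy : 4 ≤ y) (hyK : y < K) :
    1 ≤ baseSq n K j x y := by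
  have := one_le_level n y
  unfold baseSq
  split_ifs <;> first | omega | linarith

variable {T : Finset ℕ} (h0 : 0 ∉ T) (h1 : 1 ∉ T) (hK : 4 ≤ K)

include h0 h1 hK in
/-- The anchor `0` is an optimal center of its cluster. -/
lemma clusterCost_anchor_zero_le {p : ℝ≥0∞} (hp : 1 ≤ p) {c : Fin n}
    (hc : c ∈ cluster n (pairSide T) false K) :
    clusterCost (pairInstance hn hKn j hε) p (cluster n (pairSide T) false K)
        ⟨0, by omega⟩ ≤
      clusterCost (pairInstance hn hKn j hε) p (cluster n (pairSide T) false K) c := by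
  obtain ⟨s0, s1, s2, s3⟩ := pairSide_zero_to_three h0 h1
  refine clusterCost_le_of_center hp (by simp [s0]; omega) hc fun x hx hx0 hxc hc0 => ?_
  refine le_trans ?_ (sqrt_baseSq_le_d hn hKn j hε hxc)
  rw [mem_cluster] at hx hc
  have hx0' : x.1 ≠ 0 := fun h => hx0 (Fin.ext h)
  have hc0' : c.1 ≠ 0 := fun h => hc0 (Fin.ext h)
  have hx1 : x.1 ≠ 1 := fun h => by rw [h, s1] at hx; simp at hx
  have hx3 : x.1 ≠ 3 := fun h => by rw [h, s3] at hx; simp at hx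
  have hb := baseSq_lower (n := n) (K := K) (j := j) (min x.1 c.1) (max x.1 c.1)
  by_cases hx2 : x.1 = 2
  · rw [show x = ⟨2, by omega⟩ from Fin.ext hx2, pairInstance_d_two_zero hn hKn j hε _ _ hK]
    exact Real.sqrt_le_sqrt (baseSq_lower _ _).1
  · rw [pairInstance_d_zero hn hKn j hε _ (by omega) hx.1]
    apply Real.sqrt_le_sqrt
    rcases hb.2.2 with h | h | h
    · omega
    · omega
    · exact h

include h0 h1 hK in
/-- The anchor `1` is an optimal center of its cluster. -/
lemma clusterCost_anchor_one_le {p : ℝ≥0∞} (hp : 1 ≤ p) {c : Fin n}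
    (hc : c ∈ cluster n (pairSide T) true K) :
    clusterCost (pairInstance hn hKn j hε) p (cluster n (pairSide T) true K)
        ⟨1, by omega⟩ ≤
      clusterCost (pairInstance hn hKn j hε) p (cluster n (pairSide T) true K) c := by
  obtain ⟨s0, s1, s2, s3⟩ := pairSide_zero_to_three h0 h1
  refine clusterCost_le_of_center hp (by simp [s1]; omega) hc fun x hx hx1 hxc hc1 => ?_
  refine le_trans ?_ (sqrt_baseSq_le_d hn hKn j hε hxc)
  rw [mem_cluster] at hx hc
  have hx1' : x.1 ≠ 1 := fun h => hx1 (Fin.ext h)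
  have hc1' : c.1 ≠ 1 := fun h => hc1 (Fin.ext h)
  have hxc' : x.1 ≠ c.1 := fun h => hxc (Fin.ext h)
  have hx0 : x.1 ≠ 0 := fun h => by rw [h, s0] at hx; simp at hx
  have hx2 : x.1 ≠ 2 := fun h => by rw [h, s2] at hx; simp at hx
  have hc0 : c.1 ≠ 0 := fun h => by rw [h, s0] at hc; simp at hc
  have hc2 : c.1 ≠ 2 := fun h => by rw [h, s2] at hc; simp at hc
  by_cases hx3 : x.1 = 3
  · rw [show x = ⟨3, by omega⟩ from Fin.ext hx3, pairInstance_d_three_one hn hKn j hε _ _ hK]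
    apply Real.sqrt_le_sqrt
    rcases (baseSq_lower (n := n) (K := K) (j := j) (min 3 c.1) (max 3 c.1)).2.1 with h | h
    · omega
    · exact h
  · rw [pairInstance_d_one hn hKn j hε _ (by omega) hx.1]
    apply Real.sqrt_le_sqrt
    refine le_trans ?_ (one_le_baseSq (j := j) (by omega) (by omega) (by omega))
    split_ifs <;> norm_num

/-! ### Transporting one bit pattern to another -/

/-- Exchange the points of the pairs on which two bit patterns differ. -/
def pairTransport (T T' : Finset ℕ) (x : ℕ) : ℕ :=
  if x / 2 ∈ T ↔ x / 2 ∈ T' then x else if x % 2 = 0 then x + 1 else x - 1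

lemma pairTransport_div (T T' : Finset ℕ) (x : ℕ) : pairTransport T T' x / 2 = x / 2 := by
  unfold pairTransport
  split_ifs <;> omega

lemma pairTransport_self_inverse (T T' : Finset ℕ) (x : ℕ) :
    pairTransport T T' (pairTransport T T' x) = x := by
  have h := pairTransport_div T T' x
  rw [pairTransport, h, pairTransport]
  split_ifs <;> omega

lemma pairSide_pairTransport (T T' : Finset ℕ) (x : ℕ) :
    pairSide T' (pairTransport T T' x) = pairSide T x := by
  have h := pairTransport_div T T' x
  unfold pairSide
  rw [h]
  unfold pairTransport
  have h1 : (x + 1) % 2 = 0 ↔ ¬ x % 2 = 0 := by omega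
  have h2 : ¬ x % 2 = 0 → (x - 1) % 2 = 0 := by omega
  by_cases hT : x / 2 ∈ T <;> by_cases hT' : x / 2 ∈ T' <;> by_cases hx : x % 2 = 0 <;>
    simp [hT, hT', hx, h1, h2]

lemma pairTransport_lt {T T' : Finset ℕ} (hT : T ⊆ Finset.Ico 2 (K / 2))
    (hT' : T' ⊆ Finset.Ico 2 (K / 2)) {x : ℕ} (hx : x < K) : pairTransport T T' x < K := by
  unfold pairTransport
  split_ifs with h1 h2
  · exact hx
  · have : x / 2 ∈ Finset.Ico 2 (K / 2) := by
      by_cases h : x / 2 ∈ T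
      · exact hT h
      · exact hT' (by tauto)
    rw [Finset.mem_Ico] at this
    omega
  · omega

/-- The exchange as a map of the point set. -/
def pairTransportFin (n : ℕ) (T T' : Finset ℕ) (x : Fin n) : Fin n :=
  if h : pairTransport T T' x.1 < n then ⟨pairTransport T T' x.1, h⟩ else x

variable {T' : Finset ℕ} (hT : T ⊆ Finset.Ico 2 (K / 2)) (hT' : T' ⊆ Finset.Ico 2 (K / 2))

include hKn hT hT' in
lemma pairTransportFin_val {x : Fin n} (hx : x.1 < K) :
    (pairTransportFin n T T' x).1 = pairTransport T T' x.1 := by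
  unfold pairTransportFin
  rw [dif_pos ((pairTransport_lt hT hT' hx).trans_le hKn)]

include hKn hT hT' in
lemma pairTransportFin_mem {s : Bool} {x : Fin n} (hx : x ∈ cluster n (pairSide T) s K) :
    pairTransportFin n T T' x ∈ cluster n (pairSide T') s K := by
  rw [mem_cluster] at hx ⊢
  rw [pairTransportFin_val hKn hT hT' hx.1, pairSide_pairTransport]
  exact ⟨pairTransport_lt hT hT' hx.1, hx.2⟩

include hKn hT hT' in
lemma pairTransportFin_injOn (s : Bool) :
    Set.InjOn (pairTransportFin n T T') (cluster n (pairSide T) s K) := by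
  intro x hx y hy h
  rw [Finset.mem_coe, mem_cluster] at hx hy
  have h' := congrArg Fin.val h
  rw [pairTransportFin_val hKn hT hT' hx.1, pairTransportFin_val hKn hT hT' hy.1] at h'
  rw [Fin.ext_iff, ← pairTransport_self_inverse T T' x.1, h', pairTransport_self_inverse]

lemma pairTransport_of_lt_four {T T' : Finset ℕ} (hT : T ⊆ Finset.Ico 2 (K / 2))
    (hT' : T' ⊆ Finset.Ico 2 (K / 2)) {x : ℕ} (hx : x < 4) : pairTransport T T' x = x := by
  unfold pairTransport
  have h1 : x / 2 ∉ T := fun h => by have := hT h; rw [Finset.mem_Ico] at this; omega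
  have h2 : x / 2 ∉ T' := fun h => by have := hT' h; rw [Finset.mem_Ico] at this; omega
  simp [h1, h2]

lemma four_le_pairTransport (T T' : Finset ℕ) {x : ℕ} (hx : 4 ≤ x) :
    4 ≤ pairTransport T T' x := by
  have := pairTransport_div T T' x
  omega

include hK hT hT' in
/-- The cost of the cluster of the anchor `0` depends neither on the bit pattern nor on the marked
point. -/
lemma clusterCost_anchor_zero_le_transport {p : ℝ≥0∞} (hp : 1 ≤ p) (j' : ℕ) :
    clusterCost (pairInstance hn hKn j hε) p (cluster n (pairSide T) false K)
        ⟨0, by omega⟩ ≤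
      clusterCost (pairInstance hn hKn j' hε) p (cluster n (pairSide T') false K)
        ⟨0, by omega⟩ := by
  have h0 : 0 ∉ T := fun h => by simpa using hT h
  have h1 : 1 ∉ T := fun h => by simpa using hT h
  obtain ⟨s0, s1, s2, s3⟩ := pairSide_zero_to_three h0 h1
  refine clusterCost_le_of_injOn hp ⟨⟨0, by omega⟩, by simp [s0]; omega⟩ (pairTransportFin n T T')
    (fun q hq => pairTransportFin_mem hKn hT hT' hq) (pairTransportFin_injOn hKn hT hT' _)
    fun q hq => ?_
  rw [mem_cluster] at hq
  have hv := pairTransportFin_val hKn hT hT' hq.1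
  by_cases h4 : 4 ≤ q.1
  · rw [pairInstance_d_zero hn hKn j hε _ h4 hq.1, pairInstance_d_zero hn hKn j' hε]
    · rw [hv]
      exact four_le_pairTransport T T' h4
    · rw [hv]
      exact pairTransport_lt hT hT' hq.1
  · rw [pairTransport_of_lt_four hT hT' (by omega)] at hv
    rw [Fin.ext hv]
    have : q.1 = 0 ∨ q.1 = 2 := by
      have h1' : q.1 ≠ 1 := fun h => by rw [h, s1] at hq; simp at hq
      have h3' : q.1 ≠ 3 := fun h => by rw [h, s3] at hq; simp at hq
      omega
    rcases this with h | h
    · rw [show q = ⟨0, by omega⟩ from Fin.ext h, ClusteringInstance.d_self,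
        ClusteringInstance.d_self]
    · rw [show q = ⟨2, by omega⟩ from Fin.ext h, pairInstance_d_two_zero hn hKn j hε _ _ hK,
        pairInstance_d_two_zero hn hKn j' hε _ _ hK]

include hK hT hT' in
lemma d_anchor_one_le_transport (j' : ℕ) {q : Fin n} (hq : q ∈ cluster n (pairSide T) true K)
    (hj : q.1 ≠ 2 * j + 1 ∨ q.1 < 4) :
    (pairInstance hn hKn j hε).d q ⟨1, by omega⟩ ≤
      (pairInstance hn hKn j' hε).d (pairTransportFin n T T' q) ⟨1, by omega⟩ := by
  have h0 : 0 ∉ T := fun h => by simpa using hT h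
  have h1 : 1 ∉ T := fun h => by simpa using hT h
  obtain ⟨s0, s1, s2, s3⟩ := pairSide_zero_to_three h0 h1
  rw [mem_cluster] at hq
  have hv := pairTransportFin_val hKn hT hT' hq.1
  by_cases h4 : 4 ≤ q.1
  · rw [pairInstance_d_one hn hKn j hε _ h4 hq.1, pairInstance_d_one hn hKn j' hε,
      if_neg (by omega)]
    · apply Real.sqrt_le_sqrt
      split_ifs <;> norm_num
    · rw [hv]
      exact four_le_pairTransport T T' h4
    · rw [hv]
      exact pairTransport_lt hT hT' hq.1
  · rw [pairTransport_of_lt_four hT hT' (by omega)] at hv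
    rw [Fin.ext hv]
    have : q.1 = 1 ∨ q.1 = 3 := by
      have h1' : q.1 ≠ 0 := fun h => by rw [h, s0] at hq; simp at hq
      have h3' : q.1 ≠ 2 := fun h => by rw [h, s2] at hq; simp at hq
      omega
    rcases this with h | h
    · rw [show q = ⟨1, by omega⟩ from Fin.ext h, ClusteringInstance.d_self,
        ClusteringInstance.d_self]
    · rw [show q = ⟨3, by omega⟩ from Fin.ext h, pairInstance_d_three_one hn hKn j hε _ _ hK,
        pairInstance_d_three_one hn hKn j' hε _ _ hK]

include hK hT hT' in
/-- If the marked point is not in the cluster of the anchor `1`, the cost of that cluster is at most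
the cost of any other pattern. -/
lemma clusterCost_anchor_one_le_of_mem {p : ℝ≥0∞} (hp : 1 ≤ p) (hj : j ∈ T) (j' : ℕ) :
    clusterCost (pairInstance hn hKn j hε) p (cluster n (pairSide T) true K)
        ⟨1, by omega⟩ ≤
      clusterCost (pairInstance hn hKn j' hε) p (cluster n (pairSide T') true K)
        ⟨1, by omega⟩ := by
  have h0 : 0 ∉ T := fun h => by simpa using hT h
  have h1 : 1 ∉ T := fun h => by simpa using hT h
  obtain ⟨s0, s1, s2, s3⟩ := pairSide_zero_to_three h0 h1
  refine clusterCost_le_of_injOn hp ⟨⟨1, by omega⟩, by simp [s1]; omega⟩ (pairTransportFin n T T')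
    (fun q hq => pairTransportFin_mem hKn hT hT' hq) (pairTransportFin_injOn hKn hT hT' _)
    fun q hq => d_anchor_one_le_transport hn hKn j hε hK hT hT' j' hq (Or.inl fun h => ?_)
  rw [mem_cluster, h, pairSide_odd] at hq
  simp [hj] at hq

include hK hT in
/-- If the marked point is in the cluster of the anchor `1`, the cost of that cluster exceeds the
cost without a marked point. -/
lemma lt_clusterCost_anchor_one {p : ℝ≥0∞} (hp : 1 ≤ p) (hjK : j ∈ Finset.Ico 2 (K / 2))
    (hj : j ∉ T) :
    clusterCost (pairInstance hn hKn 0 hε) p (cluster n (pairSide ∅) true K)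
        ⟨1, by omega⟩ <
      clusterCost (pairInstance hn hKn j hε) p (cluster n (pairSide T) true K)
        ⟨1, by omega⟩ := by
  have hE : (∅ : Finset ℕ) ⊆ Finset.Ico 2 (K / 2) := Finset.empty_subset _
  obtain ⟨s0, s1, s2, s3⟩ := pairSide_zero_to_three (T := ∅) (by simp) (by simp)
  rw [Finset.mem_Ico] at hjK
  have hjlt : 2 * j + 1 < K := by omega
  set q₀ : Fin n := ⟨2 * j + 1, by omega⟩ with hq₀
  have hq₀mem : q₀ ∈ cluster n (pairSide ∅) true K := by
    simp [hq₀, pairSide_odd, hjlt]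
  have htr : pairTransportFin n ∅ T q₀ = q₀ := by
    apply Fin.ext
    rw [pairTransportFin_val hKn hE hT hjlt, hq₀]
    have : (2 * j + 1) / 2 = j := by omega
    simp [pairTransport, this, hj]
  have hd₀ : (pairInstance hn hKn j hε).d q₀ ⟨1, by omega⟩ = √(19 / 20) := by
    rw [pairInstance_d_one hn hKn j hε _ (by simp [hq₀]; omega) hjlt, if_pos rfl]
  refine clusterCost_lt_of_injOn hp (pairTransportFin n ∅ T)
    (fun q hq => pairTransportFin_mem hKn hE hT hq) (pairTransportFin_injOn hKn hE hT _)
    (fun q hq => d_anchor_one_le_transport hn hKn 0 hε hK hE hT j hq ?_) hq₀mem fun q hq => ?_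
  · omega
  · rw [htr, hd₀]
    rw [mem_cluster] at hq
    by_cases h4 : 4 ≤ q.1
    · rw [pairInstance_d_one hn hKn 0 hε _ h4 hq.1, if_neg (by omega)]
      exact Real.sqrt_lt_sqrt (by norm_num) (by norm_num)
    · have : q.1 = 1 ∨ q.1 = 3 := by
        have h1' : q.1 ≠ 0 := fun h => by rw [h, s0] at hq; simp at hq
        have h3' : q.1 ≠ 2 := fun h => by rw [h, s2] at hq; simp at hq
        omega
      rcases this with h | h
      · rw [show q = ⟨1, by omega⟩ from Fin.ext h, ClusteringInstance.d_self]
        exact Real.sqrt_pos.2 (by norm_num)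
      · rw [show q = ⟨3, by omega⟩ from Fin.ext h, pairInstance_d_three_one hn hKn 0 hε _ _ hK]
        exact Real.sqrt_lt_sqrt (by norm_num) (by norm_num)

end Output

/-! ### The objective and the marked point -/

section Objective

variable {n K : ℕ} (hn : 4 ≤ n) (hKn : K ≤ n) (hK : 4 ≤ K) {ε : ℝ} (hε : SmallPert n K ε)
  {T : Finset ℕ} (hT : T ⊆ Finset.Ico 2 (K / 2))

include hT in
lemma pairSide_zero_one : pairSide T 0 = false ∧ pairSide T 1 = true := by
  have h0 : 0 ∉ T := fun h => by simpa using hT h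
  simp [pairSide, h0]

/-- The output of the algorithm is determined when every core point is inserted on its side. -/
lemma output_pairInstance {p : ℝ≥0∞} (hp : 1 ≤ p) (j : ℕ) {α : ℝ}
    (hbest : ∀ v : Fin n, 2 ≤ v.1 → v.1 < K →
      InsertionIsBest (pairInstance hn hKn j hε) α (pairSide T) v)
    {P : Finpartition (Finset.univ : Finset (Fin n))} {c : Finset (Fin n) → Fin n}
    (hout : IsAlgorithmOutput p (n - K + 2) α (pairInstance hn hKn j hε) P c) :
    P = twoColorPartition (pairSide_zero_one hT).1 (pairSide_zero_one hT).2
        (show 2 ≤ K by omega) hKn ∧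
      (∀ C ∈ P.parts, c C ∈ C) ∧
      ∀ c' : Finset (Fin n) → Fin n,
        (∀ C ∈ (twoColorPartition (pairSide_zero_one hT).1 (pairSide_zero_one hT).2
          (show 2 ≤ K by omega) hKn).parts, c' C ∈ C) →
        clusteringObjective (pairInstance hn hKn j hε) p P c ≤
          clusteringObjective (pairInstance hn hKn j hε) p
            (twoColorPartition (pairSide_zero_one hT).1 (pairSide_zero_one hT).2
              (show 2 ≤ K by omega) hKn) c' := by
  obtain ⟨𝒯, h𝒯, hPc, hopt⟩ := hout
  obtain ⟨h1, h2⟩ := eq_twoColorPartition_of_optimal (pairSide_zero_one hT).1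
    (pairSide_zero_one hT).2 (show 2 ≤ K by omega) hKn hp h𝒯
    (IsMergeTree.cluster_mem (pairSide_zero_one hT).1 (pairSide_zero_one hT).2 (by omega) hKn
      hbest h𝒯)
    (fun x y hxy hx => pairInstance_d_far hn hKn j hε hxy hx)
    (fun x y hx hy => pairInstance_d_le_two hn hKn j hε hx hy) hPc hopt
  exact ⟨h1, hPc.2.2, h2⟩

include hK hT in
/-- The value of the objective tells on which side the marked point is. -/
lemma clusteringObjective_le_iff {p : ℝ≥0∞} (hp : 1 ≤ p) {j : ℕ} (hj : j ∈ Finset.Ico 2 (K / 2))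
    {α : ℝ}
    (hbest : ∀ v : Fin n, 2 ≤ v.1 → v.1 < K →
      InsertionIsBest (pairInstance hn hKn j hε) α (pairSide T) v)
    {P : Finpartition (Finset.univ : Finset (Fin n))} {c : Finset (Fin n) → Fin n}
    (hout : IsAlgorithmOutput p (n - K + 2) α (pairInstance hn hKn j hε) P c) :
    clusteringObjective (pairInstance hn hKn j hε) p P c ≤
      clusterCost (pairInstance hn hKn 0 hε) p (cluster n (pairSide ∅) false K) ⟨0, by omega⟩ +
        clusterCost (pairInstance hn hKn 0 hε) p (cluster n (pairSide ∅) true K) ⟨1, by omega⟩ ↔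
      j ∈ T := by
  have hE : (∅ : Finset ℕ) ⊆ Finset.Ico 2 (K / 2) := Finset.empty_subset _
  have h0 : 0 ∉ T := fun h => by simpa using hT h
  have h1 : 1 ∉ T := fun h => by simpa using hT h
  obtain ⟨s0, s1⟩ := pairSide_zero_one hT
  obtain ⟨rfl, hc, hopt⟩ := output_pairInstance hn hKn hK hε hT hp j hbest hout
  have hmem : ∀ s, cluster n (pairSide T) s K ∈
      (twoColorPartition s0 s1 (show 2 ≤ K by omega) hKn).parts := fun s =>
    mem_currentClusters.2 (Or.inl ⟨s, rfl⟩)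
  constructor
  · intro h
    by_contra hjT
    rw [clusteringObjective_twoColorPartition _ _ _ _ hp hc] at h
    have hA := clusterCost_anchor_zero_le hn hKn j hε h0 h1 hK hp (hc _ (hmem false))
    have hB := clusterCost_anchor_one_le hn hKn j hε h0 h1 hK hp (hc _ (hmem true))
    have hA' := clusterCost_anchor_zero_le_transport hn hKn 0 hε hK hE hT hp j
    have hB' := lt_clusterCost_anchor_one hn hKn j hε hK hT hp hj hjT
    linarith
  · intro hjT
    have hex : ∀ C : Finset (Fin n), ∃ x : Fin n,
        (C ∈ (twoColorPartition s0 s1 (show 2 ≤ K by omega) hKn).parts → x ∈ C) ∧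
        (C = cluster n (pairSide T) false K → x = ⟨0, by omega⟩) ∧
        (C = cluster n (pairSide T) true K → x = ⟨1, by omega⟩) := by
      intro C
      have hne : cluster n (pairSide T) false K ≠ cluster n (pairSide T) true K := by
        intro h
        have : (⟨0, by omega⟩ : Fin n) ∈ cluster n (pairSide T) true K := by
          rw [← h]; simp [s0]; omega
        simp [s0] at this
      by_cases hA : C = cluster n (pairSide T) false K
      · refine ⟨⟨0, by omega⟩, fun _ => ?_, fun _ => rfl, fun hB => absurd (hA.symm.trans hB) hne⟩
        rw [hA]; simp [s0]; omega
      by_cases hB : C = cluster n (pairSide T) true K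
      · refine ⟨⟨1, by omega⟩, fun _ => ?_, fun h => absurd h hA, fun _ => rfl⟩
        rw [hB]; simp [s1]; omega
      · exact ⟨c C, hc C, fun h => absurd h hA, fun h => absurd h hB⟩
    choose c' hc' hcA hcB using hex
    refine (hopt c' hc').trans ?_
    rw [clusteringObjective_twoColorPartition _ _ _ _ hp hc', hcA _ rfl, hcB _ rfl]
    exact add_le_add (clusterCost_anchor_zero_le_transport hn hKn j hε hK hT hE hp 0)
      (clusterCost_anchor_one_le_of_mem hn hKn j hε hK hT hE hp hjT 0)

end Objective

/-! ### The distance to a ground truth -/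

/-- The colouring of the ground truth that marks the pair `j`: only `1` and `2j` are on the side
`true`. -/
def truthSide (j x : ℕ) : Bool := decide (x = 1 ∨ (x = 2 * j ∧ x ≠ 0))

lemma truthSide_zero (j : ℕ) : truthSide j 0 = false := by simp [truthSide]

lemma truthSide_one (j : ℕ) : truthSide j 1 = true := by simp [truthSide]

section Distance

variable {n K : ℕ} {side side' : ℕ → Bool} (h0 : side 0 = false) (h1 : side 1 = true)
  (h0' : side' 0 = false) (h1' : side' 1 = true) (hK : 2 ≤ K) (hKn : K ≤ n)

lemma clusteringDist_twoColorPartition_le :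
    clusteringDist (twoColorPartition h0 h1 hK hKn) (twoColorPartition h0' h1' hK hKn) ≤
      (cluster n side false K \ cluster n side' false K).card +
        (cluster n side true K \ cluster n side' true K).card := by
  unfold clusteringDist
  refine (ciInf_le (OrderBot.bddBelow _)
    ((partLabel h0 h1 hK hKn).symm.trans (partLabel h0' h1' hK hKn))).trans ?_
  rw [← (partLabel h0 h1 hK hKn).sum_comp]
  simp only [Equiv.trans_apply, Equiv.symm_apply_apply]
  rw [Fintype.sum_sum_type, Fintype.sum_bool]
  simp only [partLabel, Equiv.ofBijective_apply, labelCluster, sdiff_self, Finset.bot_eq_empty,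
    Finset.card_empty, Finset.sum_const_zero, add_zero]
  rw [add_comm]

end Distance

/-- Distinct points that are misclassified by each matching give a lower bound on the distance. -/
lemma le_clusteringDist {n : ℕ} {P Q : Finpartition (Finset.univ : Finset (Fin n))} (J : Finset ℕ)
    (hPQ : P.parts.card = Q.parts.card)
    (h : ∀ σ : {C // C ∈ P.parts} ≃ {C // C ∈ Q.parts}, ∃ g : ℕ → Fin n, Set.InjOn g J ∧
      ∀ t ∈ J, ∃ C, g t ∈ C.1 \ (σ C).1) : J.card ≤ clusteringDist P Q := by
  unfold clusteringDist
  have : Nonempty ({C // C ∈ P.parts} ≃ {C // C ∈ Q.parts}) :=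
    ⟨Fintype.equivOfCardEq (by simpa using hPQ)⟩
  refine le_ciInf fun σ => ?_
  obtain ⟨g, hg, hmem⟩ := h σ
  calc J.card ≤ (Finset.univ.biUnion fun C : {C // C ∈ P.parts} => C.1 \ (σ C).1).card :=
        Finset.card_le_card_of_injOn g (fun t ht => by
          obtain ⟨C, hC⟩ := hmem t ht
          exact Finset.mem_coe.2 (Finset.mem_biUnion.2 ⟨C, Finset.mem_univ _, hC⟩)) hg
    _ ≤ _ := Finset.card_biUnion_le

/-- The matching misclassifies one of two points that one partition separates and the other does
not. -/
lemma exists_misclassified {n : ℕ} {P Q : Finpartition (Finset.univ : Finset (Fin n))}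
    (σ : {C // C ∈ P.parts} ≃ {C // C ∈ Q.parts}) {x y : Fin n}
    (h : ¬ ((∃ C ∈ P.parts, x ∈ C ∧ y ∈ C) ↔ ∃ D ∈ Q.parts, x ∈ D ∧ y ∈ D)) :
    ∃ z, (z = x ∨ z = y) ∧ ∃ C, z ∈ C.1 \ (σ C).1 := by
  by_contra! hno
  have hkey : ∀ z, (z = x ∨ z = y) → ∀ C : {C // C ∈ P.parts}, z ∈ C.1 → z ∈ (σ C).1 := by
    intro z hz C hzC
    by_contra hσ
    exact hno z hz C (Finset.mem_sdiff.2 ⟨hzC, hσ⟩)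
  apply h
  constructor
  · rintro ⟨C, hC, hx, hy⟩
    exact ⟨_, (σ ⟨C, hC⟩).2, hkey x (Or.inl rfl) ⟨C, hC⟩ hx, hkey y (Or.inr rfl) ⟨C, hC⟩ hy⟩
  · rintro ⟨D, hD, hx, hy⟩
    obtain ⟨C, hC, hxC⟩ := P.exists_mem (Finset.mem_univ x)
    obtain ⟨C', hC', hyC⟩ := P.exists_mem (Finset.mem_univ y)
    have e1 : (σ ⟨C, hC⟩).1 = D :=
      Q.eq_of_mem_parts (σ ⟨C, hC⟩).2 hD (hkey x (Or.inl rfl) ⟨C, hC⟩ hxC) hx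
    have e2 : (σ ⟨C', hC'⟩).1 = D :=
      Q.eq_of_mem_parts (σ ⟨C', hC'⟩).2 hD (hkey y (Or.inr rfl) ⟨C', hC'⟩ hyC) hy
    have e3 := σ.injective (Subtype.ext (e1.trans e2.symm))
    have e4 : C = C' := congrArg Subtype.val e3
    exact ⟨C, hC, hxC, e4 ▸ hyC⟩

section Truth

variable {n K : ℕ} (hKn : K ≤ n) (hK : 2 ≤ K) {T : Finset ℕ} (hT : T ⊆ Finset.Ico 2 (K / 2))

/-- Two points below `K` are in the same part iff they have the same colour. -/
lemma exists_part_iff {side : ℕ → Bool} (h0 : side 0 = false) (h1 : side 1 = true) {x y : Fin n}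
    (hx : x.1 < K) :
    (∃ C ∈ (twoColorPartition (n := n) h0 h1 hK hKn).parts, x ∈ C ∧ y ∈ C) ↔
      y.1 < K ∧ side x.1 = side y.1 := by
  simp only [twoColorPartition_parts, mem_currentClusters]
  constructor
  · rintro ⟨C, ⟨s, rfl⟩ | ⟨z, hz, rfl⟩, hxC, hyC⟩
    · rw [mem_cluster] at hxC hyC
      exact ⟨hyC.1, hxC.2.trans hyC.2.symm⟩
    · rw [Finset.mem_singleton] at hxC
      subst hxC
      omega
  · rintro ⟨hy, hs⟩
    exact ⟨cluster n side (side x.1) K, Or.inl ⟨_, rfl⟩, mem_cluster.2 ⟨hx, rfl⟩,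
      mem_cluster.2 ⟨hy, hs.symm⟩⟩

/-- Every pair other than the marked one and the pair of anchors `0, 1` contributes one
misclassified point; the marked pair contributes another one iff `2j` is on the wrong side. -/
lemma clusteringDist_truth_le_iff {j : ℕ} (hj : j ∈ Finset.Ico 2 (K / 2)) :
    clusteringDist (twoColorPartition (pairSide_zero_one hT).1 (pairSide_zero_one hT).2 hK hKn)
      (twoColorPartition (truthSide_zero j) (truthSide_one j) hK hKn) ≤ K / 2 - 2 ↔ j ∈ T := by
  obtain ⟨s0, s1⟩ := pairSide_zero_one hT
  have hj' := Finset.mem_Ico.1 hj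
  constructor
  · intro h
    by_contra hjT
    have hcard : (Finset.Ico 1 (K / 2)).card = K / 2 - 1 := Nat.card_Ico _ _
    have hlow := le_clusteringDist
      (P := twoColorPartition (n := n) s0 s1 hK hKn)
      (Q := twoColorPartition (truthSide_zero j) (truthSide_one j) hK hKn) (Finset.Ico 1 (K / 2))
      (by rw [card_twoColorPartition, card_twoColorPartition]) (fun σ => by
        have hex : ∀ t, ∃ z : Fin n, t ∈ Finset.Ico 1 (K / 2) →
            (t = j → z.1 = 0 ∨ z.1 = 2 * j) ∧ (t ≠ j → z.1 / 2 = t) ∧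
            ∃ C, z ∈ C.1 \ (σ C).1 := by
          intro t
          by_cases ht : t ∈ Finset.Ico 1 (K / 2)
          swap
          · exact ⟨⟨0, by omega⟩, fun h => absurd h ht⟩
          rw [Finset.mem_Ico] at ht
          by_cases htj : t = j
          · obtain ⟨z, hz, hC⟩ := exists_misclassified σ (x := ⟨0, by omega⟩)
              (y := ⟨2 * j, by omega⟩) (by
                rw [exists_part_iff hKn hK s0 s1 (by simp; omega),
                  exists_part_iff hKn hK (truthSide_zero j) (truthSide_one j) (by simp; omega)]
                have : j ≠ 0 := by omega
                simp only [s0, pairSide_even, hjT, decide_false, truthSide]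
                simp [this]
                omega)
            refine ⟨z, fun _ => ⟨fun _ => ?_, fun h => absurd htj h, hC⟩⟩
            rcases hz with rfl | rfl
            · exact Or.inl rfl
            · exact Or.inr rfl
          · obtain ⟨z, hz, hC⟩ := exists_misclassified σ (x := ⟨2 * t, by omega⟩)
              (y := ⟨2 * t + 1, by omega⟩) (by
                rw [exists_part_iff hKn hK s0 s1 (by simp; omega),
                  exists_part_iff hKn hK (truthSide_zero j) (truthSide_one j) (by simp; omega)]
                have e1 : t ≠ 0 := by omega
                have e2 : 2 * t + 1 ≠ 2 * j := by omega
                have e3 : 2 * t ≠ 1 := by omega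
                simp only [pairSide_even, pairSide_odd, truthSide]
                simp [e1, e2, e3, htj]
                omega)
            refine ⟨z, fun _ => ⟨fun h => absurd h htj, fun _ => ?_, hC⟩⟩
            rcases hz with rfl | rfl
            · simp
            · simp only
              omega
        choose g hg using hex
        refine ⟨g, fun t ht t' ht' htt' => ?_, fun t ht => (hg t ht).2.2⟩
        obtain ⟨a1, a2, -⟩ := hg t ht
        obtain ⟨b1, b2, -⟩ := hg t' ht'
        rw [Finset.mem_coe, Finset.mem_Ico] at ht ht'
        have hval := congrArg Fin.val htt'
        by_cases c1 : t = j <;> by_cases c2 : t' = j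
        · rw [c1, c2]
        · have := a1 c1
          have := b2 c2
          omega
        · have := a2 c1
          have := b1 c2
          omega
        · have := a2 c1
          have := b2 c2
          omega)
    omega
  · intro hjT
    refine (clusteringDist_twoColorPartition_le _ _ _ _ hK hKn).trans ?_
    have hA : cluster n (pairSide T) false K \ cluster n (truthSide j) false K = ∅ := by
      rw [Finset.sdiff_eq_empty_iff_subset]
      intro x hx
      rw [mem_cluster] at hx ⊢
      refine ⟨hx.1, ?_⟩
      have h1 : x.1 ≠ 1 := fun h => by rw [h, s1] at hx; simp at hx
      have h2 : x.1 ≠ 2 * j := fun h => by rw [h, pairSide_even] at hx; simp [hjT] at hx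
      simp [truthSide, h1, h2]
    rw [hA, Finset.card_empty, zero_add]
    have hcard : ((Finset.Ico 1 (K / 2)).erase j).card = K / 2 - 2 := by
      rw [Finset.card_erase_of_mem (Finset.mem_Ico.2 ⟨by omega, hj'.2⟩), Nat.card_Ico]
      omega
    rw [← hcard]
    have hodd : ∀ x : Fin n, x ∈ cluster n (pairSide T) true K → x.1 % 2 = 0 → x.1 / 2 ∈ T := by
      intro x hx heven
      have := (mem_cluster.1 hx).2
      simpa [pairSide, heven] using this
    have hodd' : ∀ x : Fin n, x ∈ cluster n (pairSide T) true K → x.1 % 2 = 1 → x.1 / 2 ∉ T := by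
      intro x hx hodd
      have := (mem_cluster.1 hx).2
      simpa [pairSide, hodd] using this
    refine Finset.card_le_card_of_injOn (fun x => x.1 / 2) (fun x hx => ?_)
      fun x hx y hy hxy => ?_
    · rw [Finset.mem_coe, Finset.mem_sdiff] at hx
      obtain ⟨hx, hx'⟩ := hx
      have hxK := (mem_cluster.1 hx).1
      have hne : x.1 ≠ 1 ∧ x.1 ≠ 2 * j := by
        constructor <;> intro h <;> apply hx' <;> rw [mem_cluster] <;> refine ⟨hxK, ?_⟩
        · rw [h, truthSide_one]
        · have : j ≠ 0 := by omega
          simp [truthSide, h, this]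
      change x.1 / 2 ∈ (Finset.Ico 1 (K / 2)).erase j
      rw [Finset.mem_erase, Finset.mem_Ico]
      rcases Nat.mod_two_eq_zero_or_one x.1 with hm | hm
      · have := Finset.mem_Ico.1 (hT (hodd x hx hm))
        omega
      · have := hodd' x hx hm
        refine ⟨fun h => this (h ▸ hjT), ?_, ?_⟩ <;> omega
    · have hx := (Finset.mem_sdiff.1 (Finset.mem_coe.1 hx)).1
      have hy := (Finset.mem_sdiff.1 (Finset.mem_coe.1 hy)).1
      simp only at hxy
      rcases Nat.mod_two_eq_zero_or_one x.1 with hm | hm <;>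
        rcases Nat.mod_two_eq_zero_or_one y.1 with hm' | hm'
      · exact Fin.ext (by omega)
      · exact absurd (hxy ▸ hodd x hx hm) (hodd' y hy hm')
      · exact absurd (hxy ▸ hodd y hy hm') (hodd' x hx hm)
      · exact Fin.ext (by omega)

end Truth

/-! ### Linear lower bounds for the pseudo-dimension -/

theorem exists_shattered_objectiveClass {n K : ℕ} (hKn : K ≤ n) (hK : 4 ≤ K) {p : ℝ≥0∞}
    (hp : 1 ≤ p) {alg : AlgorithmFamily n} (halg : alg.Implements p (n - K + 2)) :
    ∃ S : Finset (ClusteringInstance n), S.card = K / 2 - 2 ∧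
      IsShattered (objectiveClass alg p (Set.Ioo (1 : ℝ) 3)) S := by
  have hn : 4 ≤ n := hK.trans hKn
  obtain ⟨ε, hε, h⟩ := exists_perturbation hn hKn
  rw [← Nat.card_Ico 2 (K / 2)]
  refine exists_isShattered (Finset.Ico 2 (K / 2)) (fun j => pairInstance hn hKn j hε)
    (clusterCost (pairInstance hn hKn 0 hε) p (cluster n (pairSide ∅) false K) ⟨0, by omega⟩ +
      clusterCost (pairInstance hn hKn 0 hε) p (cluster n (pairSide ∅) true K) ⟨1, by omega⟩)
    fun T hT => ?_
  obtain ⟨hα, hbest⟩ := h T (hT.trans (Finset.Ico_subset_Ico_right (by omega)))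
  exact ⟨_, ⟨_, hα, rfl⟩, fun j hj => clusteringObjective_le_iff hn hKn hK hε hT hp hj
    (hbest j (by rw [Finset.mem_Ico] at hj; omega)) (halg _ _)⟩

theorem exists_shattered_groundTruthClass {n K k : ℕ} (hKn : K ≤ n) (hK : 4 ≤ K)
    (hk : n - K + 2 = k) {p : ℝ≥0∞} (hp : 1 ≤ p) {alg : AlgorithmFamily n}
    (halg : alg.Implements p k) :
    ∃ S : Finset (LabeledInstance n k), S.card = K / 2 - 2 ∧
      IsShattered (groundTruthClass alg k (Set.Ioo (1 : ℝ) 3)) S := by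
  subst hk
  have hn : 4 ≤ n := hK.trans hKn
  have hK2 : 2 ≤ K := by omega
  obtain ⟨ε, hε, h⟩ := exists_perturbation hn hKn
  rw [← Nat.card_Ico 2 (K / 2)]
  refine exists_isShattered (Finset.Ico 2 (K / 2)) (fun j => (pairInstance hn hKn 0 hε,
    ⟨twoColorPartition (truthSide_zero j) (truthSide_one j) hK2 hKn,
      card_twoColorPartition _ _ _ _⟩)) ((K / 2 - 2 : ℕ) : ℝ) fun T hT => ?_
  obtain ⟨hα, hbest⟩ := h T (hT.trans (Finset.Ico_subset_Ico_right (by omega)))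
  refine ⟨_, ⟨_, hα, rfl⟩, fun j hj => ?_⟩
  simp only [Nat.cast_le]
  rw [(output_pairInstance hn hKn hK hε hT hp 0 (hbest 0 (by omega)) (halg _ _)).1]
  exact clusteringDist_truth_le_iff hKn hK2 hT hj

theorem mainTheorem5 :
    (∀ n : ℕ, 8 ≤ n →
      ∃ (V : ClusteringInstance n) (S : Finset ℝ) (tree : ℝ → Finset (Finset (Fin n))),
        S.card = 2 ^ ((n - 8) / 2) + 2 ∧
        (∀ α ∈ S, α ∈ Set.Ioo (1 : ℝ) 3) ∧
        (∀ α ∈ S, ∀ T : Finset (Finset (Fin n)), IsMergeTree V α T ↔ T = tree α) ∧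
        Set.InjOn tree (S : Set ℝ)) ∧
    (∃ c : ℝ, 0 < c ∧ ∀ k : ℕ, 2 ≤ k → ∃ n₀ : ℕ, ∀ n : ℕ, n₀ ≤ n →
      ∀ p : ℝ≥0∞, 1 ≤ p → ∀ alg : AlgorithmFamily n, alg.Implements p k →
        ((∃ S : Finset (ClusteringInstance n), c * (n : ℝ) ≤ (S.card : ℝ) ∧
            IsShattered (objectiveClass alg p (Set.Ioo (1 : ℝ) 3)) S) ∧
          (⌈c * (n : ℝ)⌉₊ : ℕ∞) ≤ pseudoDimension (objectiveClass alg p Set.univ)) ∧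
        ((∃ S : Finset (LabeledInstance n k), c * (n : ℝ) ≤ (S.card : ℝ) ∧
            IsShattered (groundTruthClass alg k (Set.Ioo (1 : ℝ) 3)) S) ∧
          (⌈c * (n : ℝ)⌉₊ : ℕ∞) ≤ pseudoDimension (groundTruthClass alg k Set.univ))) := by
  refine ⟨exists_many_mergeTrees, 1 / 4, by norm_num, fun k hk => ⟨4 * k + 20, ?_⟩⟩
  intro n hn p hp alg halg
  -- All but `k - 2` of the points are core points.
  obtain ⟨K, hK⟩ : ∃ K, n = K + (k - 2) := ⟨n - (k - 2), by omega⟩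
  have hk' : n - K + 2 = k := by omega
  have hcard : (1 / 4 : ℝ) * n ≤ ((K / 2 - 2 : ℕ) : ℝ) := by
    have h4 : n ≤ 4 * (K / 2 - 2) := by omega
    have h5 : (n : ℝ) ≤ 4 * ((K / 2 - 2 : ℕ) : ℝ) := by exact_mod_cast h4
    linarith
  have hdim : ∀ {X : Type} {H H' : Set (X → ℝ)} {S : Finset X}, H ⊆ H' → S.card = K / 2 - 2 →
      IsShattered H S → (⌈(1 / 4 : ℝ) * n⌉₊ : ℕ∞) ≤ pseudoDimension H' := by
    intro X H H' S hH hS hsh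
    refine le_trans ?_ (hsh.mono hH).card_le_pseudoDimension
    rw [hS]
    exact_mod_cast Nat.ceil_le.2 hcard
  obtain ⟨S, hS, hsh⟩ := exists_shattered_objectiveClass (n := n) (K := K) (by omega) (by omega)
    hp (by rw [hk']; exact halg)
  obtain ⟨S', hS', hsh'⟩ := exists_shattered_groundTruthClass (n := n) (K := K) (by omega)
    (by omega) hk' hp halg
  refine ⟨⟨⟨S, by rw [hS]; exact hcard, hsh⟩, hdim ?_ hS hsh⟩,
    ⟨S', by rw [hS']; exact hcard, hsh'⟩, hdim ?_ hS' hsh'⟩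
  · rintro _ ⟨α, _, rfl⟩
    exact ⟨α, trivial, rfl⟩
  · rintro _ ⟨α, _, rfl⟩
    exact ⟨α, trivial, rfl⟩
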